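/- For real $x,y,z$ let $$E(x,y,z)=\frac1{2\pi}\iint_{\mathbb R^2}\exp\{-i(x\xi+y\eta)\}\exp\{-iz(\xi^2+\eta^2)+i(\xi^3-3\xi\eta^2)\}\,d\xi\,d\eta$$ be the elliptic umbilic integral, understood as an improper double integral, i.e. as the limit of the integrals over rectangles $[a_1,a_2]\times[b_1,b_2]$ as $a_1,b_1\to-\infty$ and $a_2,b_2\to+\infty$ independently. For each $z$ let the caustic be the curve $x+iy=\frac{z^2}{3}e^{it}(2+e^{-3it})$, $t\in[0,2\pi)$, in the $(x,y)$ plane. Then the limit defining $E(x,y,z)$ exists for all real $x,y,z$, the function $(x,y)\mapsto E(x,y,0)$ is infinitely differentiable, all series below converge absolutely, and the following hold for all real $x,y,z$. (1) For all real $a,b$, $$E(x,y,z)=\exp\left(-iax-iby-iz[a^2+b^2]+i[a^3-3ab^2]\right)\sum_{n\ge0}\frac{i^n}{n!}\left\{[z-3a]\partial_x^2+6b\,\partial_x\partial_y+[z+3a]\partial_y^2\right\}^nE(x+2az-3[a^2-b^2],\,y+2bz+6ab,\,0).$$ (2) For every real $t_0$ the point $(x_0,y_0)$ given by $$x_0=\frac{z^2}{3}(2\cos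 t_0+\cos 2t_0),\qquad y_0=\frac{z^2}{3}(2\sin t_0-\sin 2t_0)$$ lies on the caustic, and $$E(x,y,z)=\exp\left(\frac{iz}{3}[x\cos t_0+y\sin t_0]-\frac{iz^3}{27}[3+\cos 3t_0]\right)\sum_{n\ge0}\frac{(2iz)^n}{n!}\left\{\cos\frac{t_0}{2}\,\partial_x-\sin\frac{t_0}{2}\,\partial_y\right\}^{2n}E(x-x_0,\,y-y_0,\,0).$$ (3) In particular, the points $(z^2,0)$ and $(-z^2/3,0)$ lie on the caustic, and $$E(x,y,z)=\exp\left(\frac{ixz}{3}-\frac{4iz^3}{27}\right)\sum_{n\ge0}\frac{(2iz)^n}{n!}\partial_x^{2n}E(x-z^2,y,0)=\exp\left(-\frac{ixz}{3}-\frac{2iz^3}{27}\right)\sum_{n\ge0}\frac{(2iz)^n}{n!}\partial_y^{2n}E\left(x+\frac{z^2}{3},y,0\right).$$ In all these formulas the derivatives are taken with respect to $x,y$ with $a,b,z,t_0,x_0,y_0$ held fixed. -/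

import Mathlib

open Filter Topology
open scoped ContDiff

/-- The truncated two-dimensional Fourier integral
`(1 / 2π) ∫_{a₁}^{a₂} ∫_{b₁}^{b₂} exp (-i (x ξ + y η)) f (ξ, η) dη dξ`
over the rectangle `[a₁, a₂] × [b₁, b₂]`, encoded as `r = ((a₁, a₂), (b₁, b₂))`. -/
noncomputable def fourierTrunc (f : ℝ → ℝ → ℂ) (x y : ℝ) (r : (ℝ × ℝ) × (ℝ × ℝ)) : ℂ :=
  1 / (2 * (Real.pi : ℂ)) *
    ∫ ξ in r.1.1..r.1.2, ∫ η in r.2.1..r.2.2,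
      Complex.exp (-Complex.I * ((x : ℂ) * ξ + (y : ℂ) * η)) * f ξ η

/-- The rectangles `[a₁, a₂] × [b₁, b₂]` exhausting the plane: `a₁, b₁ → -∞` and
`a₂, b₂ → +∞`, all four independently. -/
def exhaustPlane : Filter ((ℝ × ℝ) × (ℝ × ℝ)) :=
  (atBot ×ˢ atTop) ×ˢ (atBot ×ˢ atTop)

/-- The two-dimensional Fourier transform, as an improper double integral over the plane. -/
noncomputable def fourier2 (f : ℝ → ℝ → ℂ) (x y : ℝ) : ℂ :=
  limUnder exhaustPlane (fourierTrunc f x y)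

/-- `exp (-i z (ξ² + η²) + i (ξ³ - 3 ξ η²))`. -/
noncomputable def umbilicInitial (z ξ η : ℝ) : ℂ :=
  Complex.exp (-Complex.I * z * ((ξ : ℂ) ^ 2 + (η : ℂ) ^ 2)
    + Complex.I * ((ξ : ℂ) ^ 3 - 3 * (ξ : ℂ) * (η : ℂ) ^ 2))

/-- The elliptic umbilic canonical integral `E(x, y, z)`. -/
noncomputable def ellipticUmbilic (x y z : ℝ) : ℂ :=
  fourier2 (umbilicInitial z) x y

/-- The section at level `z` of the caustic of the elliptic umbilic: the curve
`x + i y = (z² / 3) e^{it} (2 + e^{-3it})`, `t ∈ [0, 2π)`. -/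
def caustic (z : ℝ) : Set (ℝ × ℝ) :=
  {p | ∃ t ∈ Set.Ico (0 : ℝ) (2 * Real.pi),
    (p.1 : ℂ) + Complex.I * p.2 =
      (z : ℂ) ^ 2 / 3 * Complex.exp (Complex.I * t) * (2 + Complex.exp (-3 * Complex.I * t))}

/-- The partial derivative `∂_x`. -/
noncomputable def partialX (F : ℝ → ℝ → ℂ) : ℝ → ℝ → ℂ :=
  fun x y => deriv (fun s => F s y) x

/-- The partial derivative `∂_y`. -/
noncomputable def partialY (F : ℝ → ℝ → ℂ) : ℝ → ℝ → ℂ :=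
  fun x y => deriv (fun s => F x s) y

/-- The first-order operator `α ∂_x + β ∂_y`. -/
noncomputable def dirOp (α β : ℝ) (F : ℝ → ℝ → ℂ) : ℝ → ℝ → ℂ :=
  fun x y => (α : ℂ) * partialX F x y + (β : ℂ) * partialY F x y

/-- The second-order operator `α ∂_x² + β ∂_x ∂_y + γ ∂_y²`. -/
noncomputable def quadOp (α β γ : ℝ) (F : ℝ → ℝ → ℂ) : ℝ → ℝ → ℂ :=
  fun x y => (α : ℂ) * partialX (partialX F) x y + (β : ℂ) * partialX (partialY F) x y
    + (γ : ℂ) * partialY (partialY F) x y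

/-!
The elliptic umbilic integral is conditionally convergent, and its integrand `exp (iφ)` is
oscillatory with a cubic phase `φ = Re (ξ + iη)³ + lower order terms`. The proof replaces it by an
absolutely convergent integral over a two-dimensional chain in `ℂ²`, on which every operation in
the theorem (differentiation in `x, y`, summation of the operator series) can be done under the
integral sign.

*Convergence.* Since `1 = 1 / (1 + |∇φ|²) + ∇φ ⬝ ∇φ / (1 + |∇φ|²)`, one integration by parts along
the field `∇φ / (1 + |∇φ|²)` turns the integral over a rectangle into a flux through its sides plus
the integral of a remainder of size `O((1 + |ξ| + |η|)⁻³)`, which is integrable over the plane; the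
flux vanishes as the sides recede independently, because `|∇φ|` is of order `ξ² + η²`. The estimates
are uniform under multiplication of the integrand by `exp (-ε (ξ² + η²))`, so the improper integral
is also the limit of these absolutely convergent regularizations
(`exists_tendsto_integral_rect_and_regularized`).

*The chain.* For `ε > 0` the `η`-integral is Gaussian, with value a function of `ξ` that is analytic
off a vertical cut in the upper half plane (`fiberIntegral`). Hence the `ξ`-line may be moved to a
contour that passes below the cut and rises to a positive height at both ends, where
`exp (i ξ³)` decays like a Gaussian. Over each contour point `ζ` the value of the Gaussian integral
is unfolded again as an integral over the rotated line `η = s (i ζ)^(-1/2)`, on which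
`exp (-3 i ζ η²) = exp (-3 s²)`. Letting `ε → 0` gives `tendsto_integral_rect_chain`. If the contour
passes at distance at least `K / 2` from the origin, with `K` large, the weight on the chain beats
`exp (R (|ξ|² + |η|²))` for any prescribed `R` (`integrable_exp_mul_norm_chainWeight`). The same
chain therefore represents the integrals for all quadratic forms of bounded size.

*The expansions.* Translating `(ξ, η)` by a real `(a, b)` multiplies the integrand by a constant,
shifts `(x, y)` and changes the quadratic form `z (ξ² + η²)` to
`q = (z - 3a) ξ² + 6b ξη + (z + 3a) η²`. On plane waves `exp (-i (x ξ + y η))` the operator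
`(z - 3a) ∂ₓ² + 6b ∂ₓ∂ᵧ + (z + 3a) ∂ᵧ²` is multiplication by `-q`, so the operator series is the
exponential series of `-i q`, summed under the integral over the chain
(`ellipticUmbilic_eq_tsum_quadOp`). The form `q` has determinant `z² - 9 (a² + b²)`. It degenerates
to a multiple of a square when `(a, b) = -(z / 3) (cos t₀, sin t₀)`; the shift of `(x, y)` is then
minus a point of the caustic, and the other expansions follow (`ellipticUmbilic_eq_tsum_dirOp`).
-/

open MeasureTheory

/-! ### Integrals over rectangles -/

theorem integral_rect_eq_setIntegral {F : ℝ × ℝ → ℂ} {a b c d : ℝ} (hab : a ≤ b) (hcd : c ≤ d)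
    (hF : IntegrableOn F (Set.Ioc a b ×ˢ Set.Ioc c d)) :
    ∫ ξ in a..b, ∫ η in c..d, F (ξ, η) = ∫ p in Set.Ioc a b ×ˢ Set.Ioc c d, F p := by
  rw [intervalIntegral.integral_of_le hab, Measure.volume_eq_prod, setIntegral_prod _ hF]
  simp only [intervalIntegral.integral_of_le hcd]

/-- The divergence theorem on a rectangle, with hypotheses on partial derivatives only. -/
theorem integral_rect_partial_add_partial {f g f₁ g₂ : ℝ → ℝ → ℂ} {a b c d : ℝ}
    (hab : a ≤ b) (hcd : c ≤ d)
    (hf : ∀ ξ ∈ Set.Icc a b, ∀ η ∈ Set.Icc c d, HasDerivAt (fun t => f t η) (f₁ ξ η) ξ)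
    (hg : ∀ ξ ∈ Set.Icc a b, ∀ η ∈ Set.Icc c d, HasDerivAt (fun t => g ξ t) (g₂ ξ η) η)
    (hf₁ : ContinuousOn (fun p : ℝ × ℝ => f₁ p.1 p.2) (Set.Icc a b ×ˢ Set.Icc c d))
    (hg₂ : ContinuousOn (fun p : ℝ × ℝ => g₂ p.1 p.2) (Set.Icc a b ×ˢ Set.Icc c d)) :
    ∫ ξ in a..b, ∫ η in c..d, (f₁ ξ η + g₂ ξ η) =
      (∫ η in c..d, (f b η - f a η)) + ∫ ξ in a..b, (g ξ d - g ξ c) := by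
  have hsub : Set.Ioc a b ×ˢ Set.Ioc c d ⊆ Set.Icc a b ×ˢ Set.Icc c d :=
    Set.prod_mono Set.Ioc_subset_Icc_self Set.Ioc_subset_Icc_self
  have hcomp : IsCompact (Set.Icc a b ×ˢ Set.Icc c d) := isCompact_Icc.prod isCompact_Icc
  have if₁ : IntegrableOn (fun p : ℝ × ℝ => f₁ p.1 p.2) (Set.Ioc a b ×ˢ Set.Ioc c d) :=
    (hf₁.integrableOn_compact hcomp).mono_set hsub
  have ig₂ : IntegrableOn (fun p : ℝ × ℝ => g₂ p.1 p.2) (Set.Ioc a b ×ˢ Set.Ioc c d) :=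
    (hg₂.integrableOn_compact hcomp).mono_set hsub
  have key := integral_rect_eq_setIntegral (F := fun p => f₁ p.1 p.2 + g₂ p.1 p.2) hab hcd
    (if₁.add ig₂)
  simp only at key
  rw [key, integral_add if₁ ig₂, ← integral_rect_eq_setIntegral hab hcd if₁,
    ← integral_rect_eq_setIntegral hab hcd ig₂]
  congr 1
  · simp only [intervalIntegral.integral_of_le hab, intervalIntegral.integral_of_le hcd]
    rw [integral_integral_swap]
    · refine setIntegral_congr_fun measurableSet_Ioc fun η hη => ?_
      have hη' := Set.Ioc_subset_Icc_self hη
      rw [← intervalIntegral.integral_of_le hab]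
      refine intervalIntegral.integral_eq_sub_of_hasDerivAt (f := fun t => f t η) ?_ ?_
      · intro ξ hξ
        rw [Set.uIcc_of_le hab] at hξ
        exact hf ξ hξ η hη'
      · refine ContinuousOn.intervalIntegrable ?_
        rw [Set.uIcc_of_le hab]
        exact hf₁.comp (f := fun ξ : ℝ => (ξ, η)) (by fun_prop) fun ξ hξ => ⟨hξ, hη'⟩
    · rw [Measure.prod_restrict]
      exact if₁
  · rw [intervalIntegral.integral_of_le hab, intervalIntegral.integral_of_le hab]
    refine setIntegral_congr_fun measurableSet_Ioc fun ξ hξ => ?_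
    have hξ' := Set.Ioc_subset_Icc_self hξ
    refine intervalIntegral.integral_eq_sub_of_hasDerivAt (f := fun t => g ξ t) ?_ ?_
    · intro η hη
      rw [Set.uIcc_of_le hcd] at hη
      exact hg ξ hξ' η hη
    · refine ContinuousOn.intervalIntegrable ?_
      rw [Set.uIcc_of_le hcd]
      exact hg₂.comp (f := fun η : ℝ => (ξ, η)) (by fun_prop) fun η hη => ⟨hξ', hη⟩

instance exhaustPlane_neBot : exhaustPlane.NeBot := by
  unfold exhaustPlane; infer_instance

instance exhaustPlane_isCountablyGenerated : exhaustPlane.IsCountablyGenerated := by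
  unfold exhaustPlane; infer_instance

theorem tendsto_exhaustPlane_left_fst : Tendsto (fun r => r.1.1) exhaustPlane atBot :=
  tendsto_fst.comp tendsto_fst

theorem tendsto_exhaustPlane_left_snd : Tendsto (fun r => r.1.2) exhaustPlane atTop :=
  tendsto_snd.comp tendsto_fst

theorem tendsto_exhaustPlane_right_fst : Tendsto (fun r => r.2.1) exhaustPlane atBot :=
  tendsto_fst.comp tendsto_snd

theorem tendsto_exhaustPlane_right_snd : Tendsto (fun r => r.2.2) exhaustPlane atTop :=
  tendsto_snd.comp tendsto_snd

theorem eventually_exhaustPlane_le : ∀ᶠ r in exhaustPlane, r.1.1 ≤ r.1.2 ∧ r.2.1 ≤ r.2.2 := by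
  filter_upwards [tendsto_exhaustPlane_left_fst.eventually_le_atBot 0,
    tendsto_exhaustPlane_left_snd.eventually_ge_atTop 0,
    tendsto_exhaustPlane_right_fst.eventually_le_atBot 0,
    tendsto_exhaustPlane_right_snd.eventually_ge_atTop 0] with r h1 h2 h3 h4
  exact ⟨h1.trans h2, h3.trans h4⟩

/-- For an absolutely integrable function the improper integral over rectangles is the Lebesgue
integral over the plane. -/
theorem tendsto_integral_rect {F : ℝ × ℝ → ℂ} (hF : Integrable F) :
    Tendsto (fun r : (ℝ × ℝ) × (ℝ × ℝ) => ∫ ξ in r.1.1..r.1.2, ∫ η in r.2.1..r.2.2, F (ξ, η))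
      exhaustPlane (𝓝 (∫ p, F p)) := by
  have hcov : AECover (volume : Measure (ℝ × ℝ)) exhaustPlane
      (fun r => Set.Ioc r.1.1 r.1.2 ×ˢ Set.Ioc r.2.1 r.2.2) := by
    refine ⟨Eventually.of_forall fun p => ?_, fun r => measurableSet_Ioc.prod measurableSet_Ioc⟩
    filter_upwards [tendsto_exhaustPlane_left_fst.eventually_lt_atBot p.1,
      tendsto_exhaustPlane_left_snd.eventually_ge_atTop p.1,
      tendsto_exhaustPlane_right_fst.eventually_lt_atBot p.2,
      tendsto_exhaustPlane_right_snd.eventually_ge_atTop p.2] with r h1 h2 h3 h4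
    exact ⟨⟨h1, h2⟩, ⟨h3, h4⟩⟩
  refine (hcov.integral_tendsto_of_countably_generated hF).congr' ?_
  filter_upwards [eventually_exhaustPlane_le] with r hr
  exact (integral_rect_eq_setIntegral hr.1 hr.2 hF.integrableOn).symm

/-- Flux of a field bounded by `C / (1 + a² + t²)` through a side at distance `a` vanishes in the
limit, uniformly in the length of the side. -/
theorem tendsto_integral_side {ι : Type*} {l : Filter ι} [l.IsCountablyGenerated] {C : ℝ}
    {a c d : ι → ℝ} {f : ℝ → ℝ → ℂ}
    (ha : Tendsto (fun i => a i ^ 2) l atTop)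
    (hf : ∀ s t, ‖f s t‖ ≤ C / (1 + s ^ 2 + t ^ 2)) :
    Tendsto (fun i => ∫ t in c i..d i, f (a i) t) l (𝓝 0) := by
  have hC : 0 ≤ C := by
    have := (norm_nonneg _).trans (hf 0 0)
    simpa using this
  have hmaj : Integrable (fun t : ℝ => C / (1 + t ^ 2)) := by
    simpa [div_eq_mul_inv] using integrable_inv_one_add_sq.const_mul C
  have hle : ∀ s t : ℝ, C / (1 + s ^ 2 + t ^ 2) ≤ C / (1 + t ^ 2) := fun s t => by
    gcongr
    nlinarith [sq_nonneg s]
  have hnn : ∀ s t : ℝ, 0 ≤ C / (1 + s ^ 2 + t ^ 2) := fun s t => by positivity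
  have hcont : ∀ s : ℝ, Continuous (fun t : ℝ => C / (1 + s ^ 2 + t ^ 2)) := fun s => by
    refine Continuous.div (by fun_prop) (by fun_prop) fun t => by positivity
  have hint : ∀ s : ℝ, Integrable (fun t : ℝ => C / (1 + s ^ 2 + t ^ 2)) := fun s =>
    hmaj.mono' (hcont s).aestronglyMeasurable
      (Eventually.of_forall fun t => by rw [Real.norm_of_nonneg (hnn s t)]; exact hle s t)
  have hlim : Tendsto (fun i => ∫ t, C / (1 + a i ^ 2 + t ^ 2)) l (𝓝 (∫ _t : ℝ, (0 : ℝ))) := by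
    refine tendsto_integral_filter_of_dominated_convergence _
      (Eventually.of_forall fun i => (hcont _).aestronglyMeasurable)
      (Eventually.of_forall fun i => Eventually.of_forall fun t => ?_) hmaj
      (Eventually.of_forall fun t => ?_)
    · rw [Real.norm_of_nonneg (hnn _ t)]; exact hle _ t
    · refine Tendsto.div_atTop tendsto_const_nhds ?_
      exact tendsto_atTop_add_const_right _ _ (tendsto_atTop_add_const_left _ _ ha)
  rw [integral_zero] at hlim
  refine squeeze_zero_norm (fun i => ?_) hlim
  refine (intervalIntegral.norm_integral_le_integral_norm_uIoc).trans ?_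
  have h1 : ∫ t in Set.uIoc (c i) (d i), ‖f (a i) t‖ ≤
      ∫ t in Set.uIoc (c i) (d i), C / (1 + a i ^ 2 + t ^ 2) := by
    refine integral_mono_of_nonneg (Eventually.of_forall fun t => norm_nonneg _)
      (hint _).integrableOn (Eventually.of_forall fun t => hf _ t)
  exact h1.trans (setIntegral_le_integral (hint _) (Eventually.of_forall fun t => hnn _ t))

/-! ### Integration by parts against the gradient of the phase -/

/-- First partial derivative, in `ξ`, of the phase
`ξ³ - 3 ξ η² - (A ξ² + B ξ η + C η²) - (x ξ + y η)`. -/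
def phaseX (A B x ξ η : ℝ) : ℝ := 3 * (ξ ^ 2 - η ^ 2) - 2 * A * ξ - B * η - x

/-- First partial derivative, in `η`, of the phase
`ξ³ - 3 ξ η² - (A ξ² + B ξ η + C η²) - (x ξ + y η)`. -/
def phaseY (B C y ξ η : ℝ) : ℝ := -6 * ξ * η - B * ξ - 2 * C * η - y

/-- The integrand `exp (i (ξ³ - 3 ξ η² - (A ξ² + B ξ η + C η²) - (x ξ + y η)))`, regularized by the
Gaussian factor `exp (-ε (ξ² + η²))`. -/
noncomputable def regIntegrand (A B C x y ε ξ η : ℝ) : ℂ :=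
  Complex.exp (Complex.I * ((ξ ^ 3 - 3 * ξ * η ^ 2 - (A * ξ ^ 2 + B * ξ * η + C * η ^ 2)
    - (x * ξ + y * η) : ℝ) : ℂ) - ((ε * (ξ ^ 2 + η ^ 2) : ℝ) : ℂ))

/-- `1 + |∇φ|²`, where `φ` is the phase. -/
def gradDenom (A B C x y ξ η : ℝ) : ℝ := 1 + phaseX A B x ξ η ^ 2 + phaseY B C y ξ η ^ 2

/-- The `ξ`-derivative of the first component of `∇φ / (1 + |∇φ|²)`. -/
noncomputable def gradFieldX (A B C x y ξ η : ℝ) : ℝ :=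
  (6 * ξ - 2 * A) / gradDenom A B C x y ξ η - phaseX A B x ξ η *
    (2 * phaseX A B x ξ η * (6 * ξ - 2 * A) + 2 * phaseY B C y ξ η * (-6 * η - B)) /
      gradDenom A B C x y ξ η ^ 2

/-- The `η`-derivative of the second component of `∇φ / (1 + |∇φ|²)`. -/
noncomputable def gradFieldY (A B C x y ξ η : ℝ) : ℝ :=
  (-6 * ξ - 2 * C) / gradDenom A B C x y ξ η - phaseY B C y ξ η *
    (2 * phaseX A B x ξ η * (-6 * η - B) + 2 * phaseY B C y ξ η * (-6 * ξ - 2 * C)) /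
      gradDenom A B C x y ξ η ^ 2

/-- The remainder after integrating `regIntegrand` by parts once along `∇φ / (1 + |∇φ|²)`. -/
noncomputable def byPartsRemainder (A B C x y ε ξ η : ℝ) : ℂ :=
  regIntegrand A B C x y ε ξ η * (((1 / gradDenom A B C x y ξ η : ℝ) : ℂ) + Complex.I *
    ((gradFieldX A B C x y ξ η + gradFieldY A B C x y ξ η
      - 2 * ε * (ξ * (phaseX A B x ξ η / gradDenom A B C x y ξ η)
        + η * (phaseY B C y ξ η / gradDenom A B C x y ξ η)) : ℝ) : ℂ))

/-- First component of the integrand times the field `∇φ / (1 + |∇φ|²)`. -/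
noncomputable def fluxX (A B C x y ε ξ η : ℝ) : ℂ :=
  regIntegrand A B C x y ε ξ η * ((phaseX A B x ξ η / gradDenom A B C x y ξ η : ℝ) : ℂ)

/-- Second component of the integrand times the field `∇φ / (1 + |∇φ|²)`. -/
noncomputable def fluxY (A B C x y ε ξ η : ℝ) : ℂ :=
  regIntegrand A B C x y ε ξ η * ((phaseY B C y ξ η / gradDenom A B C x y ξ η : ℝ) : ℂ)

section ByParts

variable (A B C x y : ℝ)

theorem gradDenom_pos (ξ η : ℝ) : 0 < gradDenom A B C x y ξ η := by
  unfold gradDenom; positivity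

theorem norm_regIntegrand (ε ξ η : ℝ) :
    ‖regIntegrand A B C x y ε ξ η‖ = Real.exp (-(ε * (ξ ^ 2 + η ^ 2))) := by
  rw [regIntegrand, Complex.norm_exp]
  congr 1
  simp only [Complex.sub_re, Complex.I_mul_re, Complex.ofReal_im, Complex.ofReal_re]
  ring

theorem continuous_regIntegrand :
    Continuous (fun q : ℝ × ℝ × ℝ => regIntegrand A B C x y q.1 q.2.1 q.2.2) := by
  unfold regIntegrand; fun_prop

theorem hasDerivAt_phaseX_left (ξ η : ℝ) :
    HasDerivAt (fun t => phaseX A B x t η) (6 * ξ - 2 * A) ξ := by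
  unfold phaseX
  have := (((((hasDerivAt_id ξ).pow 2).sub_const (η ^ 2)).const_mul 3).sub
    ((hasDerivAt_id ξ).const_mul (2 * A))).sub_const (B * η) |>.sub_const x
  refine this.congr_deriv ?_
  simp only [id_eq]; push_cast; ring

theorem hasDerivAt_phaseX_right (ξ η : ℝ) :
    HasDerivAt (fun t => phaseX A B x ξ t) (-6 * η - B) η := by
  unfold phaseX
  have := (((((hasDerivAt_id η).pow 2).const_sub (ξ ^ 2)).const_mul 3).sub_const (2 * A * ξ)).sub
    ((hasDerivAt_id η).const_mul B) |>.sub_const x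
  refine this.congr_deriv ?_
  simp only [id_eq]; push_cast; ring

theorem hasDerivAt_phaseY_left (ξ η : ℝ) :
    HasDerivAt (fun t => phaseY B C y t η) (-6 * η - B) ξ := by
  unfold phaseY
  have := ((((hasDerivAt_id ξ).const_mul (-6)).mul_const η).sub
    ((hasDerivAt_id ξ).const_mul B)).sub_const (2 * C * η) |>.sub_const y
  refine this.congr_deriv ?_
  ring

theorem hasDerivAt_phaseY_right (ξ η : ℝ) :
    HasDerivAt (fun t => phaseY B C y ξ t) (-6 * ξ - 2 * C) η := by
  unfold phaseY
  have := (((hasDerivAt_id η).const_mul (-6 * ξ)).sub_const (B * ξ)).sub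
    ((hasDerivAt_id η).const_mul (2 * C)) |>.sub_const y
  refine this.congr_deriv ?_
  ring

theorem hasDerivAt_regIntegrand_left (ε ξ η : ℝ) :
    HasDerivAt (fun t => regIntegrand A B C x y ε t η)
      (regIntegrand A B C x y ε ξ η *
        (Complex.I * (phaseX A B x ξ η : ℝ) - ((2 * ε * ξ : ℝ) : ℂ))) ξ := by
  have h1 : HasDerivAt (fun t : ℝ => t ^ 3 - 3 * t * η ^ 2 - (A * t ^ 2 + B * t * η + C * η ^ 2)
      - (x * t + y * η)) (phaseX A B x ξ η) ξ := by
    have hid := hasDerivAt_id ξ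
    have := (((hid.pow 3).sub ((hid.const_mul 3).mul_const (η ^ 2))).sub
      ((((hid.pow 2).const_mul A).add ((hid.const_mul B).mul_const η)).add_const (C * η ^ 2))).sub
      ((hid.const_mul x).add_const (y * η))
    refine this.congr_deriv ?_
    simp only [id_eq, phaseX]; push_cast; ring
  have h2 : HasDerivAt (fun t : ℝ => ε * (t ^ 2 + η ^ 2)) (2 * ε * ξ) ξ := by
    have := (((hasDerivAt_id ξ).pow 2).add_const (η ^ 2)).const_mul ε
    refine this.congr_deriv ?_
    simp only [id_eq]; push_cast; ring
  exact ((h1.ofReal_comp.const_mul Complex.I).sub h2.ofReal_comp).cexp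

theorem hasDerivAt_regIntegrand_right (ε ξ η : ℝ) :
    HasDerivAt (fun t => regIntegrand A B C x y ε ξ t)
      (regIntegrand A B C x y ε ξ η *
        (Complex.I * (phaseY B C y ξ η : ℝ) - ((2 * ε * η : ℝ) : ℂ))) η := by
  have h1 : HasDerivAt (fun t : ℝ => ξ ^ 3 - 3 * ξ * t ^ 2 - (A * ξ ^ 2 + B * ξ * t + C * t ^ 2)
      - (x * ξ + y * t)) (phaseY B C y ξ η) η := by
    have hid := hasDerivAt_id η
    have := ((((hid.pow 2).const_mul (3 * ξ)).const_sub (ξ ^ 3)).sub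
      (((hid.const_mul (B * ξ)).const_add (A * ξ ^ 2)).add ((hid.pow 2).const_mul C))).sub
      ((hid.const_mul y).const_add (x * ξ))
    refine this.congr_deriv ?_
    simp only [id_eq, phaseY]; push_cast; ring
  have h2 : HasDerivAt (fun t : ℝ => ε * (ξ ^ 2 + t ^ 2)) (2 * ε * η) η := by
    have := (((hasDerivAt_id η).pow 2).const_add (ξ ^ 2)).const_mul ε
    refine this.congr_deriv ?_
    simp only [id_eq]; push_cast; ring
  exact ((h1.ofReal_comp.const_mul Complex.I).sub h2.ofReal_comp).cexp

theorem hasDerivAt_gradField_left (ξ η : ℝ) :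
    HasDerivAt (fun t => phaseX A B x t η / gradDenom A B C x y t η)
      (gradFieldX A B C x y ξ η) ξ := by
  have hX := hasDerivAt_phaseX_left A B x ξ η
  have hY := hasDerivAt_phaseY_left B C y ξ η
  have hD : HasDerivAt (fun t => gradDenom A B C x y t η)
      (2 * phaseX A B x ξ η * (6 * ξ - 2 * A) + 2 * phaseY B C y ξ η * (-6 * η - B)) ξ := by
    refine (((hX.pow 2).const_add 1).add (hY.pow 2)).congr_deriv ?_
    push_cast; ring
  refine (hX.div hD (gradDenom_pos A B C x y ξ η).ne').congr_deriv ?_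
  have := (gradDenom_pos A B C x y ξ η).ne'
  unfold gradFieldX
  field_simp

theorem hasDerivAt_gradField_right (ξ η : ℝ) :
    HasDerivAt (fun t => phaseY B C y ξ t / gradDenom A B C x y ξ t)
      (gradFieldY A B C x y ξ η) η := by
  have hX := hasDerivAt_phaseX_right A B x ξ η
  have hY := hasDerivAt_phaseY_right B C y ξ η
  have hD : HasDerivAt (fun t => gradDenom A B C x y ξ t)
      (2 * phaseX A B x ξ η * (-6 * η - B) + 2 * phaseY B C y ξ η * (-6 * ξ - 2 * C)) η := by
    refine (((hX.pow 2).const_add 1).add (hY.pow 2)).congr_deriv ?_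
    push_cast; ring
  refine (hY.div hD (gradDenom_pos A B C x y ξ η).ne').congr_deriv ?_
  have := (gradDenom_pos A B C x y ξ η).ne'
  unfold gradFieldY
  field_simp

theorem continuous_phaseX : Continuous (fun p : ℝ × ℝ => phaseX A B x p.1 p.2) := by
  unfold phaseX; fun_prop

theorem continuous_phaseY : Continuous (fun p : ℝ × ℝ => phaseY B C y p.1 p.2) := by
  unfold phaseY; fun_prop

theorem continuous_gradDenom : Continuous (fun p : ℝ × ℝ => gradDenom A B C x y p.1 p.2) := by
  unfold gradDenom phaseX phaseY; fun_prop

theorem continuous_gradFieldX : Continuous (fun p : ℝ × ℝ => gradFieldX A B C x y p.1 p.2) := by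
  have h1 := continuous_phaseX A B x
  have h2 := continuous_phaseY B C y
  have h3 := continuous_gradDenom A B C x y
  have h4 := fun p : ℝ × ℝ => (gradDenom_pos A B C x y p.1 p.2).ne'
  unfold gradFieldX
  exact (Continuous.div (by fun_prop) h3 h4).sub
    (Continuous.div (by fun_prop) (h3.pow 2) fun p => pow_ne_zero 2 (h4 p))

theorem continuous_gradFieldY : Continuous (fun p : ℝ × ℝ => gradFieldY A B C x y p.1 p.2) := by
  have h1 := continuous_phaseX A B x
  have h2 := continuous_phaseY B C y
  have h3 := continuous_gradDenom A B C x y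
  have h4 := fun p : ℝ × ℝ => (gradDenom_pos A B C x y p.1 p.2).ne'
  unfold gradFieldY
  exact (Continuous.div (by fun_prop) h3 h4).sub
    (Continuous.div (by fun_prop) (h3.pow 2) fun p => pow_ne_zero 2 (h4 p))

theorem continuous_byPartsRemainder :
    Continuous (fun q : ℝ × ℝ × ℝ => byPartsRemainder A B C x y q.1 q.2.1 q.2.2) := by
  have h1 := (continuous_phaseX A B x).comp (continuous_snd (X := ℝ) (Y := ℝ × ℝ))
  have h2 := (continuous_phaseY B C y).comp (continuous_snd (X := ℝ) (Y := ℝ × ℝ))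
  have h3 := (continuous_gradDenom A B C x y).comp (continuous_snd (X := ℝ) (Y := ℝ × ℝ))
  have h4 := fun q : ℝ × ℝ × ℝ => (gradDenom_pos A B C x y q.2.1 q.2.2).ne'
  have h5 := (continuous_gradFieldX A B C x y).comp (continuous_snd (X := ℝ) (Y := ℝ × ℝ))
  have h6 := (continuous_gradFieldY A B C x y).comp (continuous_snd (X := ℝ) (Y := ℝ × ℝ))
  have h7 := h1.div h3 h4
  have h8 := h2.div h3 h4
  have h9 := (continuous_const (y := (1 : ℝ))).div h3 h4
  have h0 := continuous_regIntegrand A B C x y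
  simp only [Function.comp_def] at *
  unfold byPartsRemainder
  refine h0.mul ((Complex.continuous_ofReal.comp h9).add (continuous_const.mul
    (Complex.continuous_ofReal.comp ((h5.add h6).sub (Continuous.mul (by fun_prop) ?_)))))
  exact (Continuous.mul (by fun_prop) h7).add (Continuous.mul (by fun_prop) h8)

theorem continuous_regIntegrand_right (ε : ℝ) :
    Continuous (fun p : ℝ × ℝ => regIntegrand A B C x y ε p.1 p.2) := by
  have h : Continuous (fun p : ℝ × ℝ => (ε, p)) := by fun_prop
  have := (continuous_regIntegrand A B C x y).comp h
  simpa only [Function.comp_def] using this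

theorem continuous_byPartsRemainder_right (ε : ℝ) :
    Continuous (fun p : ℝ × ℝ => byPartsRemainder A B C x y ε p.1 p.2) := by
  have h : Continuous (fun p : ℝ × ℝ => (ε, p)) := by fun_prop
  have := (continuous_byPartsRemainder A B C x y).comp h
  simpa only [Function.comp_def] using this

theorem regIntegrand_eq_remainder_sub_divergence (ε ξ η : ℝ) :
    regIntegrand A B C x y ε ξ η = byPartsRemainder A B C x y ε ξ η - Complex.I *
      ((regIntegrand A B C x y ε ξ η *
        (Complex.I * (phaseX A B x ξ η : ℝ) - ((2 * ε * ξ : ℝ) : ℂ)) *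
          ((phaseX A B x ξ η / gradDenom A B C x y ξ η : ℝ) : ℂ) +
        regIntegrand A B C x y ε ξ η * ((gradFieldX A B C x y ξ η : ℝ) : ℂ)) +
      (regIntegrand A B C x y ε ξ η *
        (Complex.I * (phaseY B C y ξ η : ℝ) - ((2 * ε * η : ℝ) : ℂ)) *
          ((phaseY B C y ξ η / gradDenom A B C x y ξ η : ℝ) : ℂ) +
        regIntegrand A B C x y ε ξ η * ((gradFieldY A B C x y ξ η : ℝ) : ℂ))) := by
  have hD : ((gradDenom A B C x y ξ η : ℝ) : ℂ) ≠ 0 := by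
    exact_mod_cast (gradDenom_pos A B C x y ξ η).ne'
  have hD' : ((gradDenom A B C x y ξ η : ℝ) : ℂ) = 1 + (phaseX A B x ξ η : ℂ) ^ 2
      + (phaseY B C y ξ η : ℂ) ^ 2 := by
    simp only [gradDenom]; push_cast; ring
  simp only [byPartsRemainder]
  generalize regIntegrand A B C x y ε ξ η = F
  generalize gradFieldX A B C x y ξ η = GX
  generalize gradFieldY A B C x y ξ η = GY
  push_cast
  generalize (gradDenom A B C x y ξ η : ℂ) = D at *
  generalize (phaseX A B x ξ η : ℂ) = P at *
  generalize (phaseY B C y ξ η : ℂ) = Q at *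
  have hI : Complex.I ^ 2 = -1 := Complex.I_sq
  field_simp
  linear_combination F * (hD' + (P ^ 2 + Q ^ 2) * hI)

/-- Since `1 = 1 / (1 + |∇φ|²) + ∇φ ⬝ ∇φ / (1 + |∇φ|²)`, the integrand is the remainder plus a
divergence, and only the flux through the sides of the rectangle is lost. -/
theorem integral_rect_regIntegrand (ε : ℝ) {a b c d : ℝ} (hab : a ≤ b) (hcd : c ≤ d) :
    ∫ ξ in a..b, ∫ η in c..d, regIntegrand A B C x y ε ξ η =
      (∫ ξ in a..b, ∫ η in c..d, byPartsRemainder A B C x y ε ξ η) - Complex.I *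
      ((∫ η in c..d, (fluxX A B C x y ε b η - fluxX A B C x y ε a η)) +
        ∫ ξ in a..b, (fluxY A B C x y ε ξ d - fluxY A B C x y ε ξ c)) := by
  have h1 := continuous_phaseX A B x
  have h2 := continuous_phaseY B C y
  have h3 := continuous_gradDenom A B C x y
  have h4 := fun p : ℝ × ℝ => (gradDenom_pos A B C x y p.1 p.2).ne'
  have h5 := continuous_gradFieldX A B C x y
  have h6 := continuous_gradFieldY A B C x y
  have h7 := Complex.continuous_ofReal.comp (h1.div h3 h4)
  have h8 := Complex.continuous_ofReal.comp (h2.div h3 h4)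
  have h0 : Continuous (fun p : ℝ × ℝ => regIntegrand A B C x y ε p.1 p.2) :=
    continuous_regIntegrand_right A B C x y ε
  have hW : Continuous (fun p : ℝ × ℝ => byPartsRemainder A B C x y ε p.1 p.2) :=
    continuous_byPartsRemainder_right A B C x y ε
  simp only [Function.comp_def] at h7 h8
  set f₁ : ℝ → ℝ → ℂ := fun ξ η => regIntegrand A B C x y ε ξ η *
        (Complex.I * (phaseX A B x ξ η : ℝ) - ((2 * ε * ξ : ℝ) : ℂ)) *
          ((phaseX A B x ξ η / gradDenom A B C x y ξ η : ℝ) : ℂ) +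
        regIntegrand A B C x y ε ξ η * ((gradFieldX A B C x y ξ η : ℝ) : ℂ) with hf₁
  set g₂ : ℝ → ℝ → ℂ := fun ξ η => regIntegrand A B C x y ε ξ η *
        (Complex.I * (phaseY B C y ξ η : ℝ) - ((2 * ε * η : ℝ) : ℂ)) *
          ((phaseY B C y ξ η / gradDenom A B C x y ξ η : ℝ) : ℂ) +
        regIntegrand A B C x y ε ξ η * ((gradFieldY A B C x y ξ η : ℝ) : ℂ) with hg₂
  have cf₁ : Continuous fun p : ℝ × ℝ => f₁ p.1 p.2 :=
    ((h0.mul (by fun_prop)).mul h7).add (h0.mul (by fun_prop))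
  have cg₂ : Continuous fun p : ℝ × ℝ => g₂ p.1 p.2 :=
    ((h0.mul (by fun_prop)).mul h8).add (h0.mul (by fun_prop))
  have df : ∀ ξ η, HasDerivAt (fun t => fluxX A B C x y ε t η) (f₁ ξ η) ξ := fun ξ η =>
    (hasDerivAt_regIntegrand_left A B C x y ε ξ η).mul
      (hasDerivAt_gradField_left A B C x y ξ η).ofReal_comp
  have dg : ∀ ξ η, HasDerivAt (fun t => fluxY A B C x y ε ξ t) (g₂ ξ η) η := fun ξ η =>
    (hasDerivAt_regIntegrand_right A B C x y ε ξ η).mul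
      (hasDerivAt_gradField_right A B C x y ξ η).ofReal_comp
  have key := integral_rect_partial_add_partial hab hcd (fun ξ _ η _ => df ξ η)
    (fun ξ _ η _ => dg ξ η) cf₁.continuousOn cg₂.continuousOn
  have hid : ∀ ξ η, regIntegrand A B C x y ε ξ η = byPartsRemainder A B C x y ε ξ η -
      Complex.I * (f₁ ξ η + g₂ ξ η) := fun ξ η =>
    regIntegrand_eq_remainder_sub_divergence A B C x y ε ξ η
  clear_value f₁ g₂
  have cs : Continuous fun p : ℝ × ℝ => f₁ p.1 p.2 + g₂ p.1 p.2 := cf₁.add cg₂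
  have cs' : Continuous fun p : ℝ × ℝ => Complex.I * (f₁ p.1 p.2 + g₂ p.1 p.2) :=
    continuous_const.mul cs
  rw [← key]
  have hcomp : IsCompact (Set.Icc a b ×ˢ Set.Icc c d) := isCompact_Icc.prod isCompact_Icc
  have hint : ∀ f : ℝ × ℝ → ℂ, Continuous f → IntegrableOn f (Set.Ioc a b ×ˢ Set.Ioc c d) :=
    fun f hf => (hf.continuousOn.integrableOn_compact hcomp).mono_set
      (Set.prod_mono Set.Ioc_subset_Icc_self Set.Ioc_subset_Icc_self)
  rw [integral_rect_eq_setIntegral hab hcd (hint _ h0),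
    integral_rect_eq_setIntegral hab hcd (hint _ hW),
    integral_rect_eq_setIntegral (F := fun p => f₁ p.1 p.2 + g₂ p.1 p.2) hab hcd
      (hint _ cs),
    ← integral_const_mul, ← integral_sub (hint _ hW) (hint _ cs')]
  exact integral_congr_ae (Eventually.of_forall fun p => hid p.1 p.2)

end ByParts

/-! ### Decay of the remainder and convergence over rectangles -/

/-- Size of a component of `∇φ / (1 + |∇φ|²)`: here `m = 1 + |ξ| + |η|`, `P` is a component of `∇φ`
and `D = 1 + |∇φ|²`. -/
theorem abs_div_le_of_sq_decay {P D K m : ℝ} (hm : 1 ≤ m) (hD : 0 < D) (hP : |P| ≤ K * m ^ 2)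
    (hmD : m ^ 4 ≤ K * D) : |P / D| ≤ K ^ 2 / m ^ 2 := by
  have hm0 : 0 < m := by linarith
  have hK : 0 ≤ K := by
    by_contra h
    have : K * D < 0 := mul_neg_of_neg_of_pos (by linarith) hD
    have : 0 < m ^ 4 := by positivity
    linarith
  rw [abs_div, abs_of_pos hD, div_le_div_iff₀ hD (by positivity)]
  calc |P| * m ^ 2 ≤ K * m ^ 2 * m ^ 2 := by gcongr
    _ = K * m ^ 4 := by ring
    _ ≤ K * (K * D) := by gcongr
    _ = K ^ 2 * D := by ring

/-- Size of a first derivative of `∇φ / (1 + |∇φ|²)`: here `m = 1 + |ξ| + |η|`, `(P, Q) = ∇φ`,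
`D = 1 + |∇φ|²`, the component differentiated is `R / D`, and `p`, `a`, `b` are second derivatives
of `φ`. -/
theorem abs_deriv_div_le_of_cube_decay {P Q p a b D K m : ℝ} (hm : 1 ≤ m) (hD : 0 < D)
    (hP : |P| ≤ K * m ^ 2) (hQ : |Q| ≤ K * m ^ 2) (hp : |p| ≤ K * m) (ha : |a| ≤ K * m)
    (hb : |b| ≤ K * m) (hmD : m ^ 4 ≤ K * D) (R : ℝ) (hR : |R| ≤ K * m ^ 2) :
    |p / D - R * (2 * P * a + 2 * Q * b) / D ^ 2| ≤ (K ^ 2 + 4 * K ^ 5) / m ^ 3 := by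
  have hm0 : 0 < m := by linarith
  have hK : 0 ≤ K := by
    by_contra h
    have : K * D < 0 := mul_neg_of_neg_of_pos (by linarith) hD
    have : 0 < m ^ 4 := by positivity
    linarith
  have h1 : |p / D| ≤ K ^ 2 / m ^ 3 := by
    rw [abs_div, abs_of_pos hD, div_le_div_iff₀ hD (by positivity)]
    calc |p| * m ^ 3 ≤ K * m * m ^ 3 := by gcongr
      _ = K * m ^ 4 := by ring
      _ ≤ K * (K * D) := by gcongr
      _ = K ^ 2 * D := by ring
  have h2 : |R * (2 * P * a + 2 * Q * b) / D ^ 2| ≤ 4 * K ^ 5 / m ^ 3 := by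
    have h3 : |2 * P * a + 2 * Q * b| ≤ 4 * K ^ 2 * m ^ 3 := by
      calc |2 * P * a + 2 * Q * b| ≤ |2 * P * a| + |2 * Q * b| := abs_add_le _ _
        _ = 2 * |P| * |a| + 2 * |Q| * |b| := by simp [abs_mul]
        _ ≤ 2 * (K * m ^ 2) * (K * m) + 2 * (K * m ^ 2) * (K * m) := by gcongr
        _ = 4 * K ^ 2 * m ^ 3 := by ring
    rw [abs_div, abs_mul, abs_of_pos (pow_pos hD 2), div_le_div_iff₀ (by positivity)
      (by positivity)]
    calc |R| * |2 * P * a + 2 * Q * b| * m ^ 3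
        ≤ K * m ^ 2 * (4 * K ^ 2 * m ^ 3) * m ^ 3 := by gcongr
      _ = 4 * K ^ 3 * (m ^ 4) ^ 2 := by ring
      _ ≤ 4 * K ^ 3 * (K * D) ^ 2 := by gcongr
      _ = 4 * K ^ 5 * D ^ 2 := by ring
  calc _ ≤ |p / D| + |R * (2 * P * a + 2 * Q * b) / D ^ 2| := abs_sub _ _
    _ ≤ K ^ 2 / m ^ 3 + 4 * K ^ 5 / m ^ 3 := add_le_add h1 h2
    _ = _ := by ring

section Decay

variable (A B C x y : ℝ)

/-- The gradient of the phase has size exactly of order `(1 + |ξ| + |η|)²` at infinity: for the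
leading cubic, `|∇ Re (ξ + i η)³|² = 9 (ξ² + η²)²`. -/
theorem exists_pow_four_le_gradDenom :
    ∃ K : ℝ, ∀ ξ η : ℝ, (1 + |ξ| + |η|) ^ 4 ≤ K * gradDenom A B C x y ξ η := by
  set k : ℝ := 3 * (4 * A ^ 2 + B ^ 2 + 4 * C ^ 2 + x ^ 2 + y ^ 2) with hk
  have hk0 : 0 ≤ k := by positivity
  refine ⟨9 * (3 + k + k ^ 2), fun ξ η => ?_⟩
  set D := gradDenom A B C x y ξ η with hD
  set r : ℝ := ξ ^ 2 + η ^ 2 with hr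
  have hr0 : 0 ≤ r := by positivity
  have h1D : 1 ≤ D := by
    rw [hD, gradDenom]; nlinarith [sq_nonneg (phaseX A B x ξ η), sq_nonneg (phaseY B C y ξ η)]
  have hm : (1 + |ξ| + |η|) ^ 2 ≤ 3 * (1 + r) := by
    have e1 := sq_abs ξ
    have e2 := sq_abs η
    nlinarith [sq_nonneg (1 - |ξ|), sq_nonneg (1 - |η|), sq_nonneg (|ξ| - |η|)]
  have hq1 : (2 * A * ξ + B * η + x) ^ 2 ≤ 3 * (4 * A ^ 2 * ξ ^ 2 + B ^ 2 * η ^ 2 + x ^ 2) := by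
    nlinarith [sq_nonneg (2 * A * ξ - B * η), sq_nonneg (2 * A * ξ - x), sq_nonneg (B * η - x)]
  have hq2 : (B * ξ + 2 * C * η + y) ^ 2 ≤ 3 * (B ^ 2 * ξ ^ 2 + 4 * C ^ 2 * η ^ 2 + y ^ 2) := by
    nlinarith [sq_nonneg (B * ξ - 2 * C * η), sq_nonneg (B * ξ - y), sq_nonneg (2 * C * η - y)]
  have hq : (2 * A * ξ + B * η + x) ^ 2 + (B * ξ + 2 * C * η + y) ^ 2 ≤ k * (1 + r) := by
    refine (add_le_add hq1 hq2).trans ?_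
    have : k * (1 + r) - (3 * (4 * A ^ 2 * ξ ^ 2 + B ^ 2 * η ^ 2 + x ^ 2) +
        3 * (B ^ 2 * ξ ^ 2 + 4 * C ^ 2 * η ^ 2 + y ^ 2)) = 3 * (4 * A ^ 2 + B ^ 2 + 4 * C ^ 2 +
        4 * A ^ 2 * η ^ 2 + 4 * C ^ 2 * ξ ^ 2 + (x ^ 2 + y ^ 2) * (ξ ^ 2 + η ^ 2)) := by
      rw [hk, hr]; ring
    have h0 : 0 ≤ 3 * (4 * A ^ 2 + B ^ 2 + 4 * C ^ 2 +
        4 * A ^ 2 * η ^ 2 + 4 * C ^ 2 * ξ ^ 2 + (x ^ 2 + y ^ 2) * (ξ ^ 2 + η ^ 2)) := by positivity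
    linarith
  have hlow : 9 / 2 * r ^ 2 ≤ D + k * (1 + r) := by
    have e : D = 1 + (3 * (ξ ^ 2 - η ^ 2) - (2 * A * ξ + B * η + x)) ^ 2 +
        (-6 * ξ * η - (B * ξ + 2 * C * η + y)) ^ 2 := by
      rw [hD, gradDenom, phaseX, phaseY]; ring
    have e2 : 9 * r ^ 2 = (3 * (ξ ^ 2 - η ^ 2)) ^ 2 + (-6 * ξ * η) ^ 2 := by rw [hr]; ring
    nlinarith [sq_nonneg (3 * (ξ ^ 2 - η ^ 2) - 2 * (2 * A * ξ + B * η + x)),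
      sq_nonneg (-6 * ξ * η - 2 * (B * ξ + 2 * C * η + y))]
  have hr2 : (1 + r) ^ 2 ≤ (3 + k + k ^ 2) * D := by
    have h3 : 7 / 2 * r ^ 2 ≤ D + k + k ^ 2 := by nlinarith [sq_nonneg (k - 2 * r)]
    have h4 : (k + k ^ 2) * 1 ≤ (k + k ^ 2) * D := by gcongr
    nlinarith [sq_nonneg (1 - r)]
  calc (1 + |ξ| + |η|) ^ 4 = ((1 + |ξ| + |η|) ^ 2) ^ 2 := by ring
    _ ≤ (3 * (1 + r)) ^ 2 := by gcongr
    _ = 9 * (1 + r) ^ 2 := by ring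
    _ ≤ 9 * ((3 + k + k ^ 2) * D) := by gcongr
    _ = _ := by ring

theorem exists_phase_bounds :
    ∃ K : ℝ, 0 < K ∧ ∀ ξ η : ℝ, (1 + |ξ| + |η|) ^ 4 ≤ K * gradDenom A B C x y ξ η ∧
      |phaseX A B x ξ η| ≤ K * (1 + |ξ| + |η|) ^ 2 ∧
      |phaseY B C y ξ η| ≤ K * (1 + |ξ| + |η|) ^ 2 ∧
      |6 * ξ - 2 * A| ≤ K * (1 + |ξ| + |η|) ∧ |-6 * η - B| ≤ K * (1 + |ξ| + |η|) ∧
      |-6 * ξ - 2 * C| ≤ K * (1 + |ξ| + |η|) := by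
  obtain ⟨K₀, hK₀⟩ := exists_pow_four_le_gradDenom A B C x y
  have hk0 : 0 ≤ 6 + 2 * |A| + |B| + 2 * |C| + |x| + |y| := by positivity
  have hK₀' : 0 ≤ K₀ := by
    by_contra h
    have h1 := hK₀ 0 0
    have : K₀ * gradDenom A B C x y 0 0 < 0 :=
      mul_neg_of_neg_of_pos (by linarith) (gradDenom_pos A B C x y 0 0)
    norm_num at h1
    linarith
  refine ⟨K₀ + (6 + 2 * |A| + |B| + 2 * |C| + |x| + |y|), by positivity, fun ξ η => ?_⟩
  have hξ := abs_nonneg ξ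
  have hη := abs_nonneg η
  have hA := abs_nonneg A
  have hB := abs_nonneg B
  have hC := abs_nonneg C
  have hx := abs_nonneg x
  have hy := abs_nonneg y
  set k := 6 + 2 * |A| + |B| + 2 * |C| + |x| + |y| with hk
  set m := 1 + |ξ| + |η| with hm
  have hm1 : 1 ≤ m := by linarith
  have hmm : m ≤ m ^ 2 := by nlinarith
  have hξm : |ξ| ≤ m := by linarith
  have hηm : |η| ≤ m := by linarith
  have lin : ∀ t, t ≤ k * m → t ≤ (K₀ + k) * m := fun t ht => by nlinarith
  have qua : ∀ t, t ≤ k * m ^ 2 → t ≤ (K₀ + k) * m ^ 2 := fun t ht => by nlinarith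
  refine ⟨?_, qua _ ?_, qua _ ?_, lin _ ?_, lin _ ?_, lin _ ?_⟩
  · have := gradDenom_pos A B C x y ξ η
    nlinarith [hK₀ ξ η]
  · have h1 : |phaseX A B x ξ η| ≤ 3 * (|ξ| ^ 2 + |η| ^ 2) + 2 * |A| * |ξ| + |B| * |η| + |x| := by
      have h3 : |3 * (ξ ^ 2 - η ^ 2)| ≤ 3 * (|ξ| ^ 2 + |η| ^ 2) := by
        rw [abs_le, sq_abs, sq_abs]
        constructor <;> nlinarith [sq_nonneg ξ, sq_nonneg η]
      have h4 : |2 * A * ξ| = 2 * |A| * |ξ| := by simp [abs_mul]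
      unfold phaseX
      have := abs_sub (3 * (ξ ^ 2 - η ^ 2) - 2 * A * ξ - B * η) x
      have := abs_sub (3 * (ξ ^ 2 - η ^ 2) - 2 * A * ξ) (B * η)
      have := abs_sub (3 * (ξ ^ 2 - η ^ 2)) (2 * A * ξ)
      have := abs_mul B η
      linarith
    have h2 : |ξ| ^ 2 + |η| ^ 2 ≤ m ^ 2 := by nlinarith [mul_nonneg hξ hη]
    have h3 : |A| * |ξ| ≤ |A| * m ^ 2 := by gcongr; linarith
    have h4 : |B| * |η| ≤ |B| * m ^ 2 := by gcongr; linarith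
    have h5 : |x| * 1 ≤ |x| * m ^ 2 := by gcongr; linarith
    have h6 : 0 ≤ (|C| + |y|) * m ^ 2 := by positivity
    nlinarith
  · have h1 : |phaseY B C y ξ η| ≤ 6 * (|ξ| * |η|) + |B| * |ξ| + 2 * |C| * |η| + |y| := by
      have h3 : |-6 * ξ * η| = 6 * (|ξ| * |η|) := by simp [abs_mul]; ring
      have h4 : |2 * C * η| = 2 * |C| * |η| := by simp [abs_mul]
      unfold phaseY
      have := abs_sub (-6 * ξ * η - B * ξ - 2 * C * η) y
      have := abs_sub (-6 * ξ * η - B * ξ) (2 * C * η)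
      have := abs_sub (-6 * ξ * η) (B * ξ)
      have := abs_mul B ξ
      linarith
    have h2 : |ξ| * |η| ≤ m ^ 2 := by nlinarith
    have h3 : |B| * |ξ| ≤ |B| * m ^ 2 := by gcongr; linarith
    have h4 : |C| * |η| ≤ |C| * m ^ 2 := by gcongr; linarith
    have h5 : |y| * 1 ≤ |y| * m ^ 2 := by gcongr; linarith
    have h6 : 0 ≤ (|A| + |x|) * m ^ 2 := by positivity
    nlinarith
  · have := abs_sub (6 * ξ) (2 * A)
    have h3 : |6 * ξ| = 6 * |ξ| := by simp [abs_mul]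
    have h4 : |2 * A| = 2 * |A| := by simp [abs_mul]
    have h5 : |A| * 1 ≤ |A| * m := by gcongr
    have h6 : 0 ≤ (|B| + 2 * |C| + |x| + |y|) * m := by positivity
    nlinarith
  · have := abs_sub (-6 * η) B
    have h3 : |-6 * η| = 6 * |η| := by simp [abs_mul]
    have h5 : |B| * 1 ≤ |B| * m := by gcongr
    have h6 : 0 ≤ (2 * |A| + 2 * |C| + |x| + |y|) * m := by positivity
    nlinarith
  · have := abs_sub (-6 * ξ) (2 * C)
    have h3 : |-6 * ξ| = 6 * |ξ| := by simp [abs_mul]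
    have h4 : |2 * C| = 2 * |C| := by simp [abs_mul]
    have h5 : |C| * 1 ≤ |C| * m := by gcongr
    have h6 : 0 ≤ (2 * |A| + |B| + |x| + |y|) * m := by positivity
    nlinarith

theorem norm_regIntegrand_le_one {ε : ℝ} (hε : 0 ≤ ε) (ξ η : ℝ) :
    ‖regIntegrand A B C x y ε ξ η‖ ≤ 1 := by
  rw [norm_regIntegrand, Real.exp_le_one_iff]
  have : 0 ≤ ε * (ξ ^ 2 + η ^ 2) := by positivity
  linarith

theorem exists_flux_bound :
    ∃ K : ℝ, ∀ ξ η : ℝ, ‖fluxX A B C x y 0 ξ η‖ ≤ K / (1 + ξ ^ 2 + η ^ 2) ∧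
      ‖fluxY A B C x y 0 ξ η‖ ≤ K / (1 + ξ ^ 2 + η ^ 2) := by
  obtain ⟨K, hK, h⟩ := exists_phase_bounds A B C x y
  refine ⟨K ^ 2, fun ξ η => ?_⟩
  obtain ⟨h4, hX, hY, -⟩ := h ξ η
  have hξ := abs_nonneg ξ
  have hη := abs_nonneg η
  have hD := gradDenom_pos A B C x y ξ η
  have hm : 1 + ξ ^ 2 + η ^ 2 ≤ (1 + |ξ| + |η|) ^ 2 := by
    nlinarith [sq_abs ξ, sq_abs η, mul_nonneg hξ hη]
  have key : ∀ P : ℝ, |P| ≤ K * (1 + |ξ| + |η|) ^ 2 →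
      ‖regIntegrand A B C x y 0 ξ η * ((P / gradDenom A B C x y ξ η : ℝ) : ℂ)‖ ≤
        K ^ 2 / (1 + ξ ^ 2 + η ^ 2) := fun P hP => by
    rw [norm_mul, Complex.norm_real, Real.norm_eq_abs]
    calc _ ≤ 1 * (K ^ 2 / (1 + |ξ| + |η|) ^ 2) := by
          gcongr
          · exact norm_regIntegrand_le_one A B C x y le_rfl ξ η
          · exact abs_div_le_of_sq_decay (by linarith) hD hP h4
      _ ≤ _ := by rw [one_mul]; gcongr
  exact ⟨key _ hX, key _ hY⟩

/-- The remainder decays like `(1 + |ξ| + |η|)⁻³`, uniformly in the regularization: absolutely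
integrable over the plane. -/
theorem exists_byPartsRemainder_bound :
    ∃ K : ℝ, ∀ ε : ℝ, 0 ≤ ε → ε ≤ 1 → ∀ ξ η : ℝ,
      ‖byPartsRemainder A B C x y ε ξ η‖ ≤ K / (1 + |ξ| + |η|) ^ 3 := by
  obtain ⟨K, hK, h⟩ := exists_phase_bounds A B C x y
  refine ⟨K + 2 * (K ^ 2 + 4 * K ^ 5) + 12 * K ^ 2, fun ε hε hε1 ξ η => ?_⟩
  obtain ⟨h4, hX, hY, ha, hb, hc⟩ := h ξ η
  have hξ := abs_nonneg ξ
  have hη := abs_nonneg η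
  have hD := gradDenom_pos A B C x y ξ η
  set m := 1 + |ξ| + |η| with hm
  have hm1 : 1 ≤ m := by linarith
  have hm0 : 0 < m := by linarith
  set e := ‖regIntegrand A B C x y ε ξ η‖ with he
  have he1 : e ≤ 1 := norm_regIntegrand_le_one A B C x y hε ξ η
  have he0 : 0 ≤ e := norm_nonneg _
  -- the derivative of the Gaussian costs a factor `ε m`, recovered from `t exp (-t) ≤ 1`
  have hem : ε * e * m ^ 2 ≤ 6 := by
    have h1 : m ^ 2 ≤ 3 * (1 + (ξ ^ 2 + η ^ 2)) := by
      nlinarith [sq_nonneg (1 - |ξ|), sq_nonneg (1 - |η|), sq_nonneg (|ξ| - |η|), sq_abs ξ,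
        sq_abs η]
    have h2 : ε * (ξ ^ 2 + η ^ 2) * e ≤ 1 := by
      rw [he, norm_regIntegrand, Real.exp_neg, ← div_eq_mul_inv, div_le_one (Real.exp_pos _)]
      linarith [Real.add_one_le_exp (ε * (ξ ^ 2 + η ^ 2))]
    have h3 : ε * e ≤ 1 := by nlinarith
    have h5 : 0 ≤ ε * e := by positivity
    calc ε * e * m ^ 2 ≤ ε * e * (3 * (1 + (ξ ^ 2 + η ^ 2))) := by gcongr
      _ = 3 * (ε * e) + 3 * (ε * (ξ ^ 2 + η ^ 2) * e) := by ring
      _ ≤ 6 := by linarith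
  have b1 : |1 / gradDenom A B C x y ξ η| ≤ K / m ^ 3 := by
    rw [abs_of_pos (by positivity), div_le_div_iff₀ hD (by positivity)]
    nlinarith [pow_pos hm0 3]
  have b2 : |gradFieldX A B C x y ξ η| ≤ (K ^ 2 + 4 * K ^ 5) / m ^ 3 :=
    abs_deriv_div_le_of_cube_decay hm1 hD hX hY ha ha hb h4 _ hX
  have b3 : |gradFieldY A B C x y ξ η| ≤ (K ^ 2 + 4 * K ^ 5) / m ^ 3 :=
    abs_deriv_div_le_of_cube_decay hm1 hD hX hY hc hb hc h4 _ hY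
  have b4 := abs_div_le_of_sq_decay hm1 hD hX h4
  have b5 := abs_div_le_of_sq_decay hm1 hD hY h4
  rw [byPartsRemainder, norm_mul, ← he]
  set P := phaseX A B x ξ η / gradDenom A B C x y ξ η
  set Q := phaseY B C y ξ η / gradDenom A B C x y ξ η
  have b6 : |ξ * P + η * Q| ≤ m * (K ^ 2 / m ^ 2) := by
    calc |ξ * P + η * Q| ≤ |ξ * P| + |η * Q| := abs_add_le _ _
      _ = |ξ| * |P| + |η| * |Q| := by rw [abs_mul, abs_mul]
      _ ≤ |ξ| * (K ^ 2 / m ^ 2) + |η| * (K ^ 2 / m ^ 2) := by gcongr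
      _ = (|ξ| + |η|) * (K ^ 2 / m ^ 2) := by ring
      _ ≤ _ := by gcongr; linarith
  have b7 : e * |2 * ε * (ξ * P + η * Q)| ≤ 12 * K ^ 2 / m ^ 3 := by
    rw [abs_mul, abs_of_nonneg (by positivity : 0 ≤ 2 * ε)]
    calc e * (2 * ε * |ξ * P + η * Q|) ≤ e * (2 * ε * (m * (K ^ 2 / m ^ 2))) := by gcongr
      _ = 2 * K ^ 2 * (ε * e * m ^ 2) / m ^ 3 := by field_simp
      _ ≤ 2 * K ^ 2 * 6 / m ^ 3 := by gcongr
      _ = _ := by ring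
  have b8 : ‖((1 / gradDenom A B C x y ξ η : ℝ) : ℂ) + Complex.I *
      ((gradFieldX A B C x y ξ η + gradFieldY A B C x y ξ η - 2 * ε * (ξ * P + η * Q) : ℝ) : ℂ)‖
      ≤ |1 / gradDenom A B C x y ξ η| + (|gradFieldX A B C x y ξ η| + |gradFieldY A B C x y ξ η|
        + |2 * ε * (ξ * P + η * Q)|) := by
    refine (norm_add_le _ _).trans ?_
    rw [norm_mul, Complex.norm_I, one_mul, Complex.norm_real, Complex.norm_real,
      Real.norm_eq_abs, Real.norm_eq_abs]
    gcongr
    exact (abs_sub _ _).trans (by gcongr; exact abs_add_le _ _)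
  calc e * _ ≤ e * (|1 / gradDenom A B C x y ξ η| + (|gradFieldX A B C x y ξ η| +
        |gradFieldY A B C x y ξ η| + |2 * ε * (ξ * P + η * Q)|)) := by gcongr
    _ = e * (|1 / gradDenom A B C x y ξ η| + |gradFieldX A B C x y ξ η| +
        |gradFieldY A B C x y ξ η|) + e * |2 * ε * (ξ * P + η * Q)| := by ring
    _ ≤ 1 * (K / m ^ 3 + (K ^ 2 + 4 * K ^ 5) / m ^ 3 + (K ^ 2 + 4 * K ^ 5) / m ^ 3) +
        12 * K ^ 2 / m ^ 3 := by gcongr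
    _ = _ := by ring

theorem integrable_inv_cube :
    Integrable (fun p : ℝ × ℝ => 1 / (1 + |p.1| + |p.2|) ^ 3) := by
  have h : Integrable (fun p : ℝ × ℝ => (1 + ‖p‖) ^ (-3 : ℝ)) :=
    integrable_one_add_norm (by simp; norm_num)
  refine h.mono' ?_ (Eventually.of_forall fun p => ?_)
  · refine Continuous.aestronglyMeasurable (Continuous.div (by fun_prop) (by fun_prop) fun p => ?_)
    positivity
  · have h1 : ‖p‖ ≤ |p.1| + |p.2| := by
      rw [Prod.norm_def, Real.norm_eq_abs, Real.norm_eq_abs]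
      exact max_le (by linarith [abs_nonneg p.2]) (by linarith [abs_nonneg p.1])
    have h2 : (1 + ‖p‖) ^ (-3 : ℝ) = 1 / (1 + ‖p‖) ^ 3 := by
      rw [Real.rpow_neg (by positivity), one_div]
      norm_cast
    rw [h2, Real.norm_of_nonneg (by positivity)]
    exact one_div_le_one_div_of_le (by positivity)
      (pow_le_pow_left₀ (by positivity) (by linarith) 3)

theorem integrable_byPartsRemainder {ε : ℝ} (hε : 0 ≤ ε) (hε1 : ε ≤ 1) :
    Integrable (fun p : ℝ × ℝ => byPartsRemainder A B C x y ε p.1 p.2) := by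
  obtain ⟨K, hK⟩ := exists_byPartsRemainder_bound A B C x y
  refine (integrable_inv_cube.const_mul K).mono'
    (continuous_byPartsRemainder_right A B C x y ε).aestronglyMeasurable
    (Eventually.of_forall fun p => ?_)
  simpa [div_eq_mul_inv] using hK ε hε hε1 p.1 p.2

theorem integrable_regIntegrand {ε : ℝ} (hε : 0 < ε) :
    Integrable (fun p : ℝ × ℝ => regIntegrand A B C x y ε p.1 p.2) := by
  have h := (integrable_exp_neg_mul_sq hε).mul_prod (integrable_exp_neg_mul_sq hε)
  rw [← Measure.volume_eq_prod] at h
  refine h.mono' (continuous_regIntegrand_right A B C x y ε).aestronglyMeasurable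
    (Eventually.of_forall fun p => ?_)
  rw [norm_regIntegrand, ← Real.exp_add]
  exact le_of_eq (by ring_nf)

theorem norm_flux_le {ε : ℝ} (hε : 0 ≤ ε) (ξ η : ℝ) :
    ‖fluxX A B C x y ε ξ η‖ ≤ ‖fluxX A B C x y 0 ξ η‖ ∧
      ‖fluxY A B C x y ε ξ η‖ ≤ ‖fluxY A B C x y 0 ξ η‖ := by
  have h : ‖regIntegrand A B C x y ε ξ η‖ ≤ ‖regIntegrand A B C x y 0 ξ η‖ := by
    refine (norm_regIntegrand_le_one A B C x y hε ξ η).trans ?_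
    simp [norm_regIntegrand]
  unfold fluxX fluxY
  simp only [norm_mul]
  constructor <;> gcongr

theorem tendsto_integral_rect_regIntegrand {ε : ℝ} (hε : 0 ≤ ε) (hε1 : ε ≤ 1) :
    Tendsto (fun r : (ℝ × ℝ) × (ℝ × ℝ) =>
      ∫ ξ in r.1.1..r.1.2, ∫ η in r.2.1..r.2.2, regIntegrand A B C x y ε ξ η)
      exhaustPlane (𝓝 (∫ p : ℝ × ℝ, byPartsRemainder A B C x y ε p.1 p.2)) := by
  obtain ⟨K, hK⟩ := exists_flux_bound A B C x y
  have hX : ∀ s t, ‖fluxX A B C x y ε s t‖ ≤ K / (1 + s ^ 2 + t ^ 2) := fun s t =>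
    (norm_flux_le A B C x y hε s t).1.trans (hK s t).1
  have hY : ∀ s t, ‖fluxY A B C x y ε t s‖ ≤ K / (1 + s ^ 2 + t ^ 2) := fun s t => by
    refine ((norm_flux_le A B C x y hε t s).2.trans (hK t s).2).trans_eq ?_
    ring_nf
  have cX : Continuous (fun p : ℝ × ℝ => fluxX A B C x y ε p.1 p.2) :=
    (continuous_regIntegrand_right A B C x y ε).mul (Complex.continuous_ofReal.comp
      ((continuous_phaseX A B x).div (continuous_gradDenom A B C x y)
        fun p => (gradDenom_pos A B C x y p.1 p.2).ne'))
  have cY : Continuous (fun p : ℝ × ℝ => fluxY A B C x y ε p.1 p.2) :=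
    (continuous_regIntegrand_right A B C x y ε).mul (Complex.continuous_ofReal.comp
      ((continuous_phaseY B C y).div (continuous_gradDenom A B C x y)
        fun p => (gradDenom_pos A B C x y p.1 p.2).ne'))
  have sqBot : Tendsto (fun t : ℝ => t ^ 2) atBot atTop := by
    simpa [Function.comp_def] using (tendsto_pow_atTop (α := ℝ) two_ne_zero).comp tendsto_abs_atBot_atTop
  have sqTop : Tendsto (fun t : ℝ => t ^ 2) atTop atTop := tendsto_pow_atTop two_ne_zero
  have l1 := tendsto_integral_side (c := fun r : (ℝ × ℝ) × (ℝ × ℝ) => r.2.1)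
    (d := fun r => r.2.2) (sqTop.comp tendsto_exhaustPlane_left_snd) hX
  have l2 := tendsto_integral_side (c := fun r : (ℝ × ℝ) × (ℝ × ℝ) => r.2.1)
    (d := fun r => r.2.2) (sqBot.comp tendsto_exhaustPlane_left_fst) hX
  have l3 := tendsto_integral_side (c := fun r : (ℝ × ℝ) × (ℝ × ℝ) => r.1.1)
    (d := fun r => r.1.2) (sqTop.comp tendsto_exhaustPlane_right_snd) hY
  have l4 := tendsto_integral_side (c := fun r : (ℝ × ℝ) × (ℝ × ℝ) => r.1.1)
    (d := fun r => r.1.2) (sqBot.comp tendsto_exhaustPlane_right_fst) hY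
  have lW := tendsto_integral_rect (integrable_byPartsRemainder A B C x y hε hε1)
  have key := lW.sub (((l1.sub l2).add (l3.sub l4)).const_mul Complex.I)
  simp only [sub_zero, add_zero, mul_zero] at key
  refine key.congr' ?_
  filter_upwards [eventually_exhaustPlane_le] with r hr
  rw [integral_rect_regIntegrand A B C x y ε hr.1 hr.2, intervalIntegral.integral_sub,
    intervalIntegral.integral_sub]
  · exact (cY.comp (by fun_prop : Continuous fun ξ : ℝ => (ξ, r.2.2))).intervalIntegrable _ _
  · exact (cY.comp (by fun_prop : Continuous fun ξ : ℝ => (ξ, r.2.1))).intervalIntegrable _ _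
  · exact (cX.comp (by fun_prop : Continuous fun η : ℝ => (r.1.2, η))).intervalIntegrable _ _
  · exact (cX.comp (by fun_prop : Continuous fun η : ℝ => (r.1.1, η))).intervalIntegrable _ _

/-- The improper integral over rectangles converges, and it is the limit of the absolutely
convergent Gaussian regularizations. -/
theorem exists_tendsto_integral_rect_and_regularized :
    ∃ L : ℂ, Tendsto (fun r : (ℝ × ℝ) × (ℝ × ℝ) =>
        ∫ ξ in r.1.1..r.1.2, ∫ η in r.2.1..r.2.2, regIntegrand A B C x y 0 ξ η)
        exhaustPlane (𝓝 L) ∧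
      Tendsto (fun ε => ∫ p : ℝ × ℝ, regIntegrand A B C x y ε p.1 p.2) (𝓝[>] 0) (𝓝 L) := by
  refine ⟨_, tendsto_integral_rect_regIntegrand A B C x y le_rfl zero_le_one, ?_⟩
  obtain ⟨K, hK⟩ := exists_byPartsRemainder_bound A B C x y
  have hev : ∀ᶠ ε in 𝓝[>] (0 : ℝ), 0 < ε ∧ ε ≤ 1 :=
    mem_of_superset (Ioc_mem_nhdsGT zero_lt_one) fun ε h => ⟨h.1, h.2⟩
  have hlim : Tendsto (fun ε => ∫ p : ℝ × ℝ, byPartsRemainder A B C x y ε p.1 p.2) (𝓝[>] 0)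
      (𝓝 (∫ p : ℝ × ℝ, byPartsRemainder A B C x y 0 p.1 p.2)) := by
    refine tendsto_integral_filter_of_dominated_convergence _
      (Eventually.of_forall fun ε =>
        (continuous_byPartsRemainder_right A B C x y ε).aestronglyMeasurable)
      (hev.mono fun ε h => Eventually.of_forall fun p => hK ε h.1.le h.2 p.1 p.2)
      ?_ (Eventually.of_forall fun p => ?_)
    · simpa [div_eq_mul_inv] using integrable_inv_cube.const_mul K
    · have h : Continuous (fun ε : ℝ => (ε, p.1, p.2)) := by fun_prop
      have := ((continuous_byPartsRemainder A B C x y).comp h).tendsto 0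
      simp only [Function.comp_def] at this
      exact this.mono_left nhdsWithin_le_nhds
  refine hlim.congr' (hev.mono fun ε h => ?_)
  exact tendsto_nhds_unique (tendsto_integral_rect_regIntegrand A B C x y h.1.le h.2)
    (tendsto_integral_rect (integrable_regIntegrand A B C x y h.1))

end Decay

/-! ### Shifting the contour of one variable -/

/-- Cauchy's theorem for the vertical homotopy `u + i s h(u)`, `0 ≤ s ≤ 1`, between the real line and
the graph of `h`: no primitive of `G` is needed, since
`∂ₛ (G(ζ) ∂ᵤζ) = ∂ᵤ (G(ζ) ∂ₛζ)` and the divergence theorem applies. -/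
theorem integral_eq_integral_contour {G : ℂ → ℂ} {U : Set ℂ} (hU : IsOpen U)
    (hG : DifferentiableOn ℂ G U) {h h' M : ℝ → ℝ} {R₀ : ℝ} (hh : ∀ u, HasDerivAt h (h' u) u)
    (hh' : Continuous h')
    (hmem : ∀ u : ℝ, ∀ s ∈ Set.Icc (0 : ℝ) 1, (u : ℂ) + s * h u * Complex.I ∈ U)
    (hint₀ : Integrable fun u : ℝ => G u)
    (hint₁ : Integrable fun u : ℝ => G (u + h u * Complex.I) * (1 + h' u * Complex.I))
    (hM : ∀ u : ℝ, R₀ ≤ |u| → ∀ s ∈ Set.Icc (0 : ℝ) 1,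
      ‖G (u + s * h u * Complex.I) * h u‖ ≤ M u)
    (hMbot : Tendsto M atBot (𝓝 0)) (hMtop : Tendsto M atTop (𝓝 0)) :
    ∫ u : ℝ, G u = ∫ u : ℝ, G (u + h u * Complex.I) * (1 + h' u * Complex.I) := by
  have hc : Continuous h := continuous_iff_continuousAt.2 fun u => (hh u).continuousAt
  set Z : ℝ → ℝ → ℂ := fun u s => (u : ℂ) + s * h u * Complex.I with hZ
  have dZu : ∀ u s, HasDerivAt (fun t => Z t s) (1 + s * h' u * Complex.I) u := fun u s =>
    ((hasDerivAt_id u).ofReal_comp).add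
      ((((hh u).ofReal_comp).const_mul (s : ℂ)).mul_const Complex.I)
  have dZs : ∀ u s, HasDerivAt (fun t => Z u t) (h u * Complex.I) s := fun u s => by
    have := ((((hasDerivAt_id s).ofReal_comp).mul_const (h u : ℂ)).mul_const
      Complex.I).const_add (u : ℂ)
    simpa [hZ] using this
  have cZ : Continuous fun p : ℝ × ℝ => Z p.1 p.2 := by
    simp only [hZ]; fun_prop
  have dG : ∀ z ∈ U, HasDerivAt G (deriv G z) z := fun z hz =>
    (hG.differentiableAt (hU.mem_nhds hz)).hasDerivAt
  have cG' : ContinuousOn (deriv G) U := (hG.deriv hU).continuousOn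
  -- the two components of the divergence-free field
  set f : ℝ → ℝ → ℂ := fun u s => G (Z u s) * (-(h u * Complex.I)) with hf
  set g : ℝ → ℝ → ℂ := fun u s => G (Z u s) * (1 + s * h' u * Complex.I) with hg
  set f₁ : ℝ → ℝ → ℂ := fun u s => deriv G (Z u s) * (1 + s * h' u * Complex.I) *
    (-(h u * Complex.I)) + G (Z u s) * (-(h' u * Complex.I)) with hf₁
  set g₂ : ℝ → ℝ → ℂ := fun u s => deriv G (Z u s) * (h u * Complex.I) *
    (1 + s * h' u * Complex.I) + G (Z u s) * (h' u * Complex.I) with hg₂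
  have hsum : ∀ u s, f₁ u s + g₂ u s = 0 := fun u s => by simp only [hf₁, hg₂]; ring
  have key : ∀ R : ℝ, 0 ≤ R → (∫ u in (-R)..R, G u) =
      (∫ s in (0 : ℝ)..1, (f R s - f (-R) s)) +
        ∫ u in (-R)..R, G (u + h u * Complex.I) * (1 + h' u * Complex.I) := by
    intro R hR
    have hmem' : ∀ p ∈ Set.Icc (-R) R ×ˢ Set.Icc (0 : ℝ) 1, Z p.1 p.2 ∈ U :=
      fun p hp => hmem p.1 p.2 hp.2
    have c1 : ContinuousOn (fun p : ℝ × ℝ => deriv G (Z p.1 p.2))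
        (Set.Icc (-R) R ×ˢ Set.Icc (0 : ℝ) 1) := cG'.comp cZ.continuousOn hmem'
    have c2 : ContinuousOn (fun p : ℝ × ℝ => G (Z p.1 p.2))
        (Set.Icc (-R) R ×ˢ Set.Icc (0 : ℝ) 1) := hG.continuousOn.comp cZ.continuousOn hmem'
    have hdiv := integral_rect_partial_add_partial (f := f) (g := g) (f₁ := f₁) (g₂ := g₂)
      (by linarith : -R ≤ R) zero_le_one
      (fun u _ s hs => ((dG _ (hmem u s hs)).comp u (dZu u s)).mul
        (((hh u).ofReal_comp.mul_const Complex.I).neg))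
      (fun u _ s hs => by
        have h1 : HasDerivAt (fun t : ℝ => 1 + (t : ℂ) * h' u * Complex.I) (h' u * Complex.I) s := by
          have := ((((hasDerivAt_id s).ofReal_comp).mul_const (h' u : ℂ)).mul_const
            Complex.I).const_add 1
          simpa using this
        exact ((dG _ (hmem u s hs)).comp s (dZs u s)).mul h1)
      ((c1.mul (Continuous.continuousOn (by fun_prop))).mul (Continuous.continuousOn (by fun_prop))
        |>.add (c2.mul (Continuous.continuousOn (by fun_prop))))
      ((c1.mul (Continuous.continuousOn (by fun_prop))).mul (Continuous.continuousOn (by fun_prop))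
        |>.add (c2.mul (Continuous.continuousOn (by fun_prop))))
    simp only [hsum, intervalIntegral.integral_zero] at hdiv
    have e0 : ∀ u, g u 0 = G u := fun u => by simp [hg, hZ]
    have e1 : ∀ u, g u 1 = G (u + h u * Complex.I) * (1 + h' u * Complex.I) := fun u => by
      simp [hg, hZ]
    simp only [e0, e1] at hdiv
    rw [intervalIntegral.integral_sub hint₁.intervalIntegrable hint₀.intervalIntegrable] at hdiv
    linear_combination hdiv
  have side : ∀ σ : ℝ → ℝ, (∀ R, |σ R| = |R|) → Tendsto (M ∘ σ) atTop (𝓝 0) →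
      Tendsto (fun R => ∫ s in (0 : ℝ)..1, f (σ R) s) atTop (𝓝 0) := fun σ hσabs hσ => by
    refine squeeze_zero_norm' ?_ hσ
    filter_upwards [eventually_ge_atTop R₀] with R hR
    have := intervalIntegral.norm_integral_le_of_norm_le_const (a := 0) (b := 1)
      (f := fun s => f (σ R) s) (C := M (σ R)) fun s hs => by
        rw [Set.uIoc_of_le zero_le_one] at hs
        have := hM (σ R) (by rw [hσabs]; exact hR.trans (le_abs_self R)) s (Set.Ioc_subset_Icc_self hs)
        simpa [hf, hZ] using this
    simpa using this
  have cside : ∀ u, IntervalIntegrable (fun s => f u s) volume 0 1 := fun u => by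
    refine ContinuousOn.intervalIntegrable ?_
    rw [Set.uIcc_of_le zero_le_one]
    exact (hG.continuousOn.comp (cZ.comp (by fun_prop : Continuous fun s : ℝ => (u, s))).continuousOn
      fun s hs => hmem u s hs).mul continuousOn_const
  have l0 := intervalIntegral_tendsto_integral hint₀ tendsto_neg_atTop_atBot tendsto_id
  have l1 := intervalIntegral_tendsto_integral hint₁ tendsto_neg_atTop_atBot tendsto_id
  have l2 := ((side id (fun _ => rfl) hMtop).sub
    (side (fun R => -R) abs_neg (hMbot.comp tendsto_neg_atTop_atBot))).add l1
  rw [sub_zero, zero_add] at l2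
  refine tendsto_nhds_unique l0 (l2.congr' ?_)
  filter_upwards [eventually_ge_atTop 0] with R hR
  have := key R hR
  rw [intervalIntegral.integral_sub (cside _) (cside _)] at this
  simpa using this.symm

/-! ### The contour and the two-dimensional chain over it -/

/-- Height above the real axis of the deformed `ξ`-contour: it dips to `-K` over the origin and
tends to `K` at both ends. -/
noncomputable def contourHeight (K u : ℝ) : ℝ := K * (u ^ 2 - K ^ 2) / (u ^ 2 + K ^ 2)

/-- Derivative of `contourHeight`. -/
noncomputable def contourSlope (K u : ℝ) : ℝ := 4 * K ^ 3 * u / (u ^ 2 + K ^ 2) ^ 2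

/-- The deformed `ξ`-contour. -/
noncomputable def contour (K u : ℝ) : ℂ := u + contourHeight K u * Complex.I

/-- The complex direction `(i ζ)^(-1/2)` of the deformed `η`-line over the contour point `ζ`; along
it the leading term `-3 i ζ η²` of the phase becomes `-3 s²`. -/
noncomputable def fiberDir (K u : ℝ) : ℂ := (Complex.I * contour K u) ^ (-(1 / 2) : ℂ)

/-- Second coordinate of the chain, `η = s (i ζ)^(-1/2)`. -/
noncomputable def chainEta (K : ℝ) (p : ℝ × ℝ) : ℂ := p.2 * fiberDir K p.1

/-- First coordinate of the chain. -/
noncomputable def chainXi (K : ℝ) (p : ℝ × ℝ) : ℂ := contour K p.1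

/-- The leading exponential `exp (i (ζ³ - 3 ζ η²))` on the chain, times the Jacobian of the
parametrization. -/
noncomputable def chainWeight (K : ℝ) (p : ℝ × ℝ) : ℂ :=
  Complex.exp (Complex.I * contour K p.1 ^ 3 - 3 * (p.2 : ℂ) ^ 2) * fiberDir K p.1 *
    (1 + contourSlope K p.1 * Complex.I)

section Contour

variable {K : ℝ}

theorem hasDerivAt_contourHeight (hK : 0 < K) (u : ℝ) :
    HasDerivAt (contourHeight K) (contourSlope K u) u := by
  have h0 : u ^ 2 + K ^ 2 ≠ 0 := by positivity
  have := ((((hasDerivAt_id u).pow 2).sub_const (K ^ 2)).const_mul K).div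
    (((hasDerivAt_id u).pow 2).add_const (K ^ 2)) h0
  refine this.congr_deriv ?_
  unfold contourSlope
  simp only [Pi.pow_apply, id_eq]
  rw [div_eq_div_iff (by positivity) (by positivity)]
  push_cast
  ring

theorem continuous_contourHeight (hK : 0 < K) : Continuous (contourHeight K) :=
  continuous_iff_continuousAt.2 fun u => (hasDerivAt_contourHeight hK u).continuousAt

theorem continuous_contourSlope (hK : 0 < K) : Continuous (contourSlope K) := by
  unfold contourSlope
  exact Continuous.div (by fun_prop) (by fun_prop) fun u => by positivity

theorem abs_contourHeight_le (hK : 0 < K) (u : ℝ) : |contourHeight K u| ≤ K := by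
  unfold contourHeight
  rw [abs_div, abs_of_pos (by positivity : 0 < u ^ 2 + K ^ 2), div_le_iff₀ (by positivity),
    abs_mul, abs_of_pos hK]
  gcongr
  rw [abs_le]
  constructor <;> nlinarith [sq_nonneg u, sq_nonneg K]

/-- The contour stays below the real axis for `|u| ≤ K`, which is where the branch cut of the
fibre integral lies. -/
theorem contourHeight_nonpos (hK : 0 < K) {u : ℝ} (hu : |u| ≤ K) : contourHeight K u ≤ 0 := by
  unfold contourHeight
  refine div_nonpos_of_nonpos_of_nonneg ?_ (by positivity)
  have : u ^ 2 ≤ K ^ 2 := sq_le_sq' (by linarith [abs_le.1 hu]) (abs_le.1 hu).2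
  nlinarith

theorem contourHeight_nonneg (hK : 0 < K) {u : ℝ} (hu : K ≤ |u|) : 0 ≤ contourHeight K u := by
  unfold contourHeight
  refine div_nonneg ?_ (by positivity)
  have : K ^ 2 ≤ u ^ 2 := by rw [← sq_abs u]; gcongr
  nlinarith

theorem contourHeight_le_abs (hK : 0 < K) (u : ℝ) : contourHeight K u ≤ |u| := by
  rcases le_total |u| K with h | h
  · exact (contourHeight_nonpos hK h).trans (abs_nonneg u)
  · exact (le_abs_self _).trans ((abs_contourHeight_le hK u).trans h)

theorem abs_contourSlope_le (hK : 0 < K) (u : ℝ) : |contourSlope K u| ≤ 2 := by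
  unfold contourSlope
  rw [abs_div, abs_of_pos (by positivity : 0 < (u ^ 2 + K ^ 2) ^ 2), div_le_iff₀ (by positivity)]
  have h1 : |4 * K ^ 3 * u| = 4 * K ^ 3 * |u| := by
    rw [abs_mul, abs_of_pos (by positivity)]
  rw [h1]
  have h2 : 2 * K * |u| ≤ u ^ 2 + K ^ 2 := by nlinarith [sq_nonneg (K - |u|), sq_abs u]
  calc 4 * K ^ 3 * |u| = 2 * K ^ 2 * (2 * K * |u|) := by ring
    _ ≤ 2 * (u ^ 2 + K ^ 2) * (u ^ 2 + K ^ 2) := by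
        gcongr
        nlinarith [sq_nonneg u]
    _ = _ := by ring

theorem norm_contour_sq (u : ℝ) : ‖contour K u‖ ^ 2 = u ^ 2 + contourHeight K u ^ 2 := by
  rw [← Complex.normSq_eq_norm_sq, contour, Complex.normSq_add_mul_I]

theorem norm_contour_le (hK : 0 < K) (u : ℝ) : ‖contour K u‖ ≤ |u| + K := by
  unfold contour
  refine (norm_add_le _ _).trans ?_
  rw [norm_mul, Complex.norm_I, mul_one, Complex.norm_real, Complex.norm_real, Real.norm_eq_abs,
    Real.norm_eq_abs]
  linarith [abs_contourHeight_le hK u]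

theorem half_le_norm_contour (hK : 0 < K) (u : ℝ) : K / 2 ≤ ‖contour K u‖ := by
  refine (pow_le_pow_iff_left₀ (by positivity) (norm_nonneg _) two_ne_zero).1 ?_
  rw [norm_contour_sq]
  rcases le_total ((K / 2) ^ 2) (u ^ 2) with h | h
  · nlinarith [sq_nonneg (contourHeight K u)]
  · have h1 : K / 2 ≤ -contourHeight K u := by
      unfold contourHeight
      rw [← neg_div, le_div_iff₀ (by positivity)]
      nlinarith
    nlinarith [sq_nonneg u]

theorem I_mul_contour_mem_slitPlane (hK : 0 < K) (u : ℝ) :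
    Complex.I * contour K u ∈ Complex.slitPlane := by
  rw [Complex.mem_slitPlane_iff]
  by_cases hu : u = 0
  · left
    subst hu
    simp [contour, contourHeight]
    field_simp
    norm_num
    exact hK
  · right
    simp [contour, hu]

theorem fiberDir_sq (hK : 0 < K) (u : ℝ) : fiberDir K u ^ 2 * (Complex.I * contour K u) = 1 := by
  have h0 := Complex.slitPlane_ne_zero (I_mul_contour_mem_slitPlane hK u)
  rw [fiberDir, ← Complex.cpow_nat_mul]
  norm_num
  rw [Complex.cpow_neg_one]
  exact inv_mul_cancel₀ h0

theorem continuous_contour (hK : 0 < K) : Continuous (contour K) := by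
  have := continuous_contourHeight hK
  unfold contour; fun_prop

theorem continuous_fiberDir (hK : 0 < K) : Continuous (fiberDir K) := by
  have := continuous_contour hK
  unfold fiberDir
  exact Continuous.cpow (by fun_prop) continuous_const fun u => I_mul_contour_mem_slitPlane hK u

theorem norm_fiberDir_sq_le (hK : 0 < K) (u : ℝ) : ‖fiberDir K u‖ ^ 2 ≤ 2 / K := by
  have h := congrArg norm (fiberDir_sq hK u)
  rw [norm_mul, norm_pow, norm_mul, Complex.norm_I, one_mul, norm_one] at h
  have h1 := half_le_norm_contour hK u
  rw [le_div_iff₀ hK]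
  nlinarith [sq_nonneg ‖fiberDir K u‖]

theorem re_I_mul_contour_cube_le (hK : 0 < K) (u : ℝ) :
    (Complex.I * contour K u ^ 3).re ≤ -(3 * K * u ^ 2) + 7 * K ^ 3 := by
  have e : (Complex.I * contour K u ^ 3).re =
      -3 * u ^ 2 * contourHeight K u + contourHeight K u ^ 3 := by
    simp [contour, pow_succ]
    ring
  -- `-3 u² h` is `-3 K u²` up to a bounded term, as `K - h` decays like `u⁻²`
  have e2 : contourHeight K u = K - 2 * K ^ 3 / (u ^ 2 + K ^ 2) := by
    unfold contourHeight
    field_simp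
    ring
  have h1 : contourHeight K u ^ 3 ≤ K ^ 3 := by
    have := abs_contourHeight_le hK u
    calc contourHeight K u ^ 3 ≤ |contourHeight K u| ^ 3 := by
          rw [← abs_pow]; exact le_abs_self _
      _ ≤ K ^ 3 := by gcongr
  have h2 : u ^ 2 * (2 * K ^ 3 / (u ^ 2 + K ^ 2)) ≤ 2 * K ^ 3 := by
    rw [← mul_div_assoc, div_le_iff₀ (by positivity)]
    nlinarith [pow_pos hK 3, mul_pos (pow_pos hK 3) (pow_pos hK 2)]
  rw [e]
  have h3 : -3 * u ^ 2 * contourHeight K u = -(3 * K * u ^ 2) +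
      3 * (u ^ 2 * (2 * K ^ 3 / (u ^ 2 + K ^ 2))) := by rw [e2]; ring
  linarith

theorem continuous_chainXi (hK : 0 < K) : Continuous (chainXi K) :=
  (continuous_contour hK).comp continuous_fst

theorem continuous_chainEta (hK : 0 < K) : Continuous (chainEta K) :=
  (Complex.continuous_ofReal.comp continuous_snd).mul
    ((continuous_fiberDir hK).comp continuous_fst)

theorem continuous_chainWeight (hK : 0 < K) : Continuous (chainWeight K) := by
  have h1 := (continuous_contour hK).comp (continuous_fst (X := ℝ) (Y := ℝ))
  have h2 := (continuous_fiberDir hK).comp (continuous_fst (X := ℝ) (Y := ℝ))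
  have h3 := (continuous_contourSlope hK).comp (continuous_fst (X := ℝ) (Y := ℝ))
  simp only [Function.comp_def] at h1 h2 h3
  unfold chainWeight
  fun_prop

/-- On the chain the weight beats every exponential of a quadratic form of size `R`, provided the
contour passes far enough below the origin: `K ≥ 2 R + 2`. -/
theorem integrable_exp_mul_norm_chainWeight {R : ℝ} (hR : 0 ≤ R) (hRK : 2 * R + 2 ≤ K) (r : ℝ) :
    Integrable (fun p => Real.exp (r * (‖chainXi K p‖ + ‖chainEta K p‖) +
      R * (‖chainXi K p‖ ^ 2 + ‖chainEta K p‖ ^ 2)) * ‖chainWeight K p‖) := by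
  have hK : 0 < K := by linarith
  have hg : Integrable (fun p : ℝ × ℝ => Real.exp (-1 * p.1 ^ 2) * Real.exp (-1 * p.2 ^ 2)) := by
    rw [Measure.volume_eq_prod]
    exact (integrable_exp_neg_mul_sq one_pos).mul_prod (integrable_exp_neg_mul_sq one_pos)
  set c : ℝ := |r| * K + r ^ 2 + K ^ 3 + 7 * K ^ 3 with hc
  have h1 := continuous_chainXi hK
  have h2 := continuous_chainEta hK
  have h3 := continuous_chainWeight hK
  refine (hg.const_mul (3 * Real.exp c)).mono' (by fun_prop) (Eventually.of_forall fun p => ?_)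
  obtain ⟨u, s⟩ := p
  rw [Real.norm_of_nonneg (by positivity)]
  have hμ : ‖fiberDir K u‖ ^ 2 ≤ 2 / K := norm_fiberDir_sq_le hK u
  have hμ1 : ‖fiberDir K u‖ ≤ 1 := by
    have : 2 / K ≤ 1 := by rw [div_le_one hK]; linarith
    exact (sq_le_one_iff₀ (norm_nonneg _)).1 (hμ.trans this)
  have hη : ‖chainEta K (u, s)‖ = |s| * ‖fiberDir K u‖ := by simp [chainEta]
  have hη1 : ‖chainEta K (u, s)‖ ≤ |s| := by
    rw [hη]; exact mul_le_of_le_one_right (abs_nonneg s) hμ1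
  have hη2 : R * ‖chainEta K (u, s)‖ ^ 2 ≤ s ^ 2 := by
    rw [hη, mul_pow, sq_abs]
    have h5 : R * (2 / K) ≤ 1 := by rw [← mul_div_assoc, div_le_one hK]; linarith
    calc R * (s ^ 2 * ‖fiberDir K u‖ ^ 2) ≤ R * (s ^ 2 * (2 / K)) := by gcongr
      _ = s ^ 2 * (R * (2 / K)) := by ring
      _ ≤ s ^ 2 * 1 := by gcongr
      _ = s ^ 2 := by ring
  have hξ1 : ‖chainXi K (u, s)‖ ≤ |u| + K := norm_contour_le hK u
  have hξ2 : R * ‖chainXi K (u, s)‖ ^ 2 ≤ K * u ^ 2 + K ^ 3 := by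
    have e : ‖chainXi K (u, s)‖ ^ 2 = u ^ 2 + contourHeight K u ^ 2 := norm_contour_sq u
    have h6 : contourHeight K u ^ 2 ≤ K ^ 2 := by
      rw [← sq_abs]; gcongr; exact abs_contourHeight_le hK u
    rw [e]
    have h7 : R ≤ K := by linarith
    calc R * (u ^ 2 + contourHeight K u ^ 2) ≤ K * (u ^ 2 + K ^ 2) := by gcongr
      _ = _ := by ring
  have hW : ‖chainWeight K (u, s)‖ ≤
      Real.exp (-(3 * K * u ^ 2) + 7 * K ^ 3 - 3 * s ^ 2) * 1 * 3 := by
    unfold chainWeight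
    rw [norm_mul, norm_mul, Complex.norm_exp]
    gcongr
    · have := re_I_mul_contour_cube_le hK u
      have e : ((3 * (s : ℂ) ^ 2)).re = 3 * s ^ 2 := by
        rw [show (3 * (s : ℂ) ^ 2) = ((3 * s ^ 2 : ℝ) : ℂ) by push_cast; ring, Complex.ofReal_re]
      simp only [Complex.sub_re, e]
      linarith
    · refine (norm_add_le _ _).trans ?_
      have := abs_contourSlope_le hK u
      simp
      linarith
  calc _ ≤ Real.exp (|r| * (|u| + K + |s|) + (K * u ^ 2 + K ^ 3 + s ^ 2)) *
        (Real.exp (-(3 * K * u ^ 2) + 7 * K ^ 3 - 3 * s ^ 2) * 1 * 3) := by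
        gcongr
        · exact le_abs_self r
        · rw [mul_add]; exact add_le_add hξ2 hη2
    _ = 3 * Real.exp (|r| * (|u| + K + |s|) + (K * u ^ 2 + K ^ 3 + s ^ 2) +
        (-(3 * K * u ^ 2) + 7 * K ^ 3 - 3 * s ^ 2)) := by
        rw [Real.exp_add _ (-(3 * K * u ^ 2) + 7 * K ^ 3 - 3 * s ^ 2)]; ring
    _ ≤ 3 * Real.exp (c + (-1 * u ^ 2) + (-1 * s ^ 2)) := by
        refine mul_le_mul_of_nonneg_left (Real.exp_le_exp.2 ?_) (by norm_num)
        have e1 := sq_nonneg (|r| - 2 * |u|)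
        have e2 := sq_nonneg (|r| - 2 * |s|)
        have e3 : 2 * u ^ 2 ≤ K * u ^ 2 := by gcongr; linarith
        rw [hc]
        nlinarith [sq_abs r, sq_abs u, sq_abs s, sq_nonneg u, sq_nonneg s, sq_nonneg r]
    _ = _ := by rw [Real.exp_add, Real.exp_add]; ring

end Contour

/-! ### The Gaussian fibre integral -/

/-- The integral of the regularized integrand in `η` along the real line, in closed form, as a
function of a complex `ξ = ζ`. It continues analytically across the upper half plane cut along
`ε + i (C + 3 ζ) ≤ 0`. -/
noncomputable def fiberIntegral (A B C x y ε : ℝ) (ζ : ℂ) : ℂ :=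
  (Real.pi / (ε + Complex.I * (C + 3 * ζ))) ^ (1 / 2 : ℂ) *
    Complex.exp (Complex.I * ζ ^ 3 - (ε + Complex.I * A) * ζ ^ 2 - Complex.I * x * ζ -
      (y + B * ζ) ^ 2 / (4 * (ε + Complex.I * (C + 3 * ζ))))

/-- The regularized integrand on the chain, with the Jacobian included. -/
noncomputable def chainIntegrand (A B C x y ε K : ℝ) (p : ℝ × ℝ) : ℂ :=
  chainWeight K p * Complex.exp (-Complex.I * (x * chainXi K p + y * chainEta K p) -
    Complex.I * (A * chainXi K p ^ 2 + B * (chainXi K p * chainEta K p) + C * chainEta K p ^ 2) -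
    ε * (chainXi K p ^ 2 + chainEta K p ^ 2))

theorem inv_mem_slitPlane {z : ℂ} (hz : z ∈ Complex.slitPlane) : z⁻¹ ∈ Complex.slitPlane := by
  have h0 : 0 < Complex.normSq z := Complex.normSq_pos.2 (Complex.slitPlane_ne_zero hz)
  rw [Complex.mem_slitPlane_iff] at hz ⊢
  rcases hz with h | h
  · left; rw [Complex.inv_re]; positivity
  · right; rw [Complex.inv_im]; exact div_ne_zero (neg_ne_zero.2 h) h0.ne'

theorem pi_div_mem_slitPlane {z : ℂ} (hz : z ∈ Complex.slitPlane) :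
    (Real.pi : ℂ) / z ∈ Complex.slitPlane := by
  have h := inv_mem_slitPlane hz
  rw [div_eq_mul_inv]
  rw [Complex.mem_slitPlane_iff] at h ⊢
  rw [Complex.re_ofReal_mul, Complex.im_ofReal_mul]
  rcases h with h | h
  · left; have := Real.pi_pos; positivity
  · right; exact mul_ne_zero Real.pi_ne_zero h

theorem re_cpow_pos {z : ℂ} (hz : z ∈ Complex.slitPlane) {c : ℝ} (hc : |c| ≤ 1 / 2) :
    0 < (z ^ (c : ℂ)).re := by
  rw [Complex.cpow_def_of_ne_zero (Complex.slitPlane_ne_zero hz), Complex.exp_re]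
  refine mul_pos (Real.exp_pos _) (Real.cos_pos_of_mem_Ioo ?_)
  have e : (Complex.log z * (c : ℂ)).im = z.arg * c := by
    rw [Complex.im_mul_ofReal, Complex.log_im]
  have h1 : |z.arg| < Real.pi := lt_of_le_of_ne (Complex.abs_arg_le_pi z) fun h => by
    rcases abs_eq Real.pi_pos.le |>.1 h with h | h
    · exact Complex.slitPlane_arg_ne_pi hz h
    · exact absurd h (Complex.neg_pi_lt_arg z).ne'
  have h2 : |z.arg * c| < Real.pi / 2 := by
    rw [abs_mul]
    calc |z.arg| * |c| ≤ |z.arg| * (1 / 2) := by gcongr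
      _ < Real.pi * (1 / 2) := by gcongr
      _ = Real.pi / 2 := by ring
  rw [e]
  exact ⟨(abs_lt.1 h2).1, (abs_lt.1 h2).2⟩

theorem cpow_half_sq (z : ℂ) : (z ^ (1 / 2 : ℂ)) ^ 2 = z := by
  simp

theorem re_cpow_half_pos {z : ℂ} (hz : z ∈ Complex.slitPlane) : 0 < (z ^ (1 / 2 : ℂ)).re := by
  have := re_cpow_pos hz (c := 1 / 2) (by norm_num [abs_of_pos])
  push_cast at this
  exact this

section Fiber

variable (A B C x y : ℝ)

theorem integral_regIntegrand_eq_fiberIntegral {ε : ℝ} (hε : 0 < ε) (u : ℝ) :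
    ∫ v : ℝ, regIntegrand A B C x y ε u v = fiberIntegral A B C x y ε u := by
  set w : ℂ := ε + Complex.I * (C + 3 * u) with hw
  have hre : (-w).re < 0 := by simp [hw, hε]
  have hw0 : w ≠ 0 := fun h => by simp [h] at hre
  have h := integral_cexp_quadratic hre (-Complex.I * (y + B * u))
    (Complex.I * u ^ 3 - (ε + Complex.I * A) * u ^ 2 - Complex.I * x * u)
  rw [fiberIntegral, ← hw]
  rw [neg_neg] at h
  convert h using 2
  · ext v
    rw [regIntegrand, hw]
    congr 1
    push_cast
    ring
  · congr 1
    have hI : Complex.I ^ 2 = -1 := Complex.I_sq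
    field_simp
    linear_combination -((y : ℂ) + B * u) ^ 2 * hI

theorem integral_plane_regIntegrand {ε : ℝ} (hε : 0 < ε) :
    Integrable (fun u : ℝ => fiberIntegral A B C x y ε u) ∧
      ∫ p : ℝ × ℝ, regIntegrand A B C x y ε p.1 p.2 = ∫ u : ℝ, fiberIntegral A B C x y ε u := by
  have h := integrable_regIntegrand A B C x y hε
  rw [Measure.volume_eq_prod] at h ⊢
  have h1 := h.integral_prod_left
  rw [integral_prod _ h]
  simp only [integral_regIntegrand_eq_fiberIntegral A B C x y hε] at h1 ⊢
  exact ⟨h1, trivial⟩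

/-- Two square roots of the same number agree once their real parts are positive; the bounds on
imaginary parts keep the product `q * r` in the right half plane. -/
theorem eq_mul_of_sq_eq {p q r : ℂ} (h : p ^ 2 = (q * r) ^ 2) (hp : 0 < p.re) (hq : 0 < q.re)
    (hr : 0 < r.re) (hq' : |q.im| ≤ 3 * q.re) (hr' : |r.im| ≤ r.re / 4) : p = q * r := by
  rcases sq_eq_sq_iff_eq_or_eq_neg.1 h with h | h
  · exact h
  · exfalso
    have h1 : |q.im * r.im| ≤ 3 * q.re * (r.re / 4) := by
      rw [abs_mul]; gcongr
    have h2 : p.re = -(q.re * r.re - q.im * r.im) := by rw [h]; simp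
    have h3 := (abs_le.1 h1).2
    nlinarith [mul_pos hq hr]

/-- The argument of `(i ζ)^(-1/2)` stays away from `±π / 2`. -/
theorem abs_im_fiberDir_le {K : ℝ} (hK : 0 < K) (u : ℝ) :
    0 < (fiberDir K u).re ∧ |(fiberDir K u).im| ≤ 3 * (fiberDir K u).re := by
  have hpos : 0 < (fiberDir K u).re := by
    have := re_cpow_pos (I_mul_contour_mem_slitPlane hK u) (c := -(1 / 2)) (by norm_num [abs_of_pos])
    push_cast at this
    exact this
  refine ⟨hpos, ?_⟩
  have hsq := fiberDir_sq hK u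
  have h0 := Complex.slitPlane_ne_zero (I_mul_contour_mem_slitPlane hK u)
  set z := Complex.I * contour K u with hz
  set μ := fiberDir K u with hμ
  have hn : 0 < Complex.normSq z := Complex.normSq_pos.2 h0
  have e : μ ^ 2 = z⁻¹ := eq_inv_of_mul_eq_one_left hsq
  have hzre : z.re = -contourHeight K u := by simp [hz, contour]
  have hzim : z.im = u := by simp [hz, contour]
  have ere : μ.re ^ 2 - μ.im ^ 2 = -contourHeight K u / Complex.normSq z := by
    rw [← hzre, ← Complex.inv_re, ← e, sq μ, Complex.mul_re]; ring
  have eim : 2 * μ.re * μ.im = -u / Complex.normSq z := by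
    rw [← hzim, ← Complex.inv_im, ← e, sq μ, Complex.mul_im]; ring
  have key : μ.im ^ 2 - μ.re ^ 2 ≤ 2 * μ.re * |μ.im| := by
    have h1 : 2 * μ.re * |μ.im| = |u| / Complex.normSq z := by
      rw [← abs_of_pos (by positivity : 0 < 2 * μ.re), ← abs_mul, eim, abs_div, abs_neg,
        abs_of_pos hn]
    have h2 : μ.im ^ 2 - μ.re ^ 2 = contourHeight K u / Complex.normSq z := by
      rw [neg_div] at ere; linarith
    rw [h1, h2]
    gcongr
    exact contourHeight_le_abs hK u
  by_contra hlt
  push Not at hlt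
  nlinarith [sq_abs μ.im]

theorem abs_im_cpow_half_le {v : ℂ} (hv : ‖v - 3‖ ≤ 1) :
    v ∈ Complex.slitPlane ∧ 0 < ((Real.pi / v : ℂ) ^ (1 / 2 : ℂ)).re ∧
      |((Real.pi / v : ℂ) ^ (1 / 2 : ℂ)).im| ≤ ((Real.pi / v : ℂ) ^ (1 / 2 : ℂ)).re / 4 := by
  have hre : 2 ≤ v.re := by
    have := (Complex.abs_re_le_norm (v - 3)).trans hv
    simp at this
    linarith [(abs_le.1 this).1]
  have him : |v.im| ≤ 1 := by
    have := (Complex.abs_im_le_norm (v - 3)).trans hv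
    simpa using this
  have hs : v ∈ Complex.slitPlane := Complex.mem_slitPlane_iff.2 (Or.inl (by linarith))
  have hpos := re_cpow_half_pos (pi_div_mem_slitPlane hs)
  refine ⟨hs, hpos, ?_⟩
  have hn : 0 < Complex.normSq v := Complex.normSq_pos.2 (Complex.slitPlane_ne_zero hs)
  have e := cpow_half_sq (Real.pi / v : ℂ)
  set r := (Real.pi / v : ℂ) ^ (1 / 2 : ℂ)
  have ere : r.re ^ 2 - r.im ^ 2 = Real.pi * (v.re / Complex.normSq v) := by
    rw [← Complex.inv_re, ← Complex.re_ofReal_mul, ← div_eq_mul_inv, ← e, sq r, Complex.mul_re]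
    ring
  have eim : 2 * r.re * r.im = Real.pi * (-v.im / Complex.normSq v) := by
    rw [← Complex.inv_im, ← Complex.im_ofReal_mul Real.pi, ← div_eq_mul_inv, ← e, sq r, Complex.mul_im]
    ring
  have key : 2 * (2 * r.re * |r.im|) ≤ r.re ^ 2 - r.im ^ 2 := by
    have h1 : 2 * r.re * |r.im| = Real.pi * (|v.im| / Complex.normSq v) := by
      rw [← abs_of_pos (by positivity : 0 < 2 * r.re), ← abs_mul, eim, abs_mul, abs_div, abs_neg,
        abs_of_pos hn, abs_of_pos Real.pi_pos]
    rw [h1, ere]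
    have h2 : 2 * (|v.im| / Complex.normSq v) ≤ v.re / Complex.normSq v := by
      rw [← mul_div_assoc]
      gcongr
      linarith
    nlinarith [Real.pi_pos]
  by_contra hlt
  push Not at hlt
  nlinarith [sq_nonneg r.im]

/-- Over each contour point the Gaussian integral along the rotated `η`-line is the analytic
continuation of the one along the real line. -/
theorem integral_chainIntegrand_fiber {ε K R : ℝ} (hε : 0 ≤ ε) (hε1 : ε ≤ 1)
    (hR : |A| + |B| + |C| + 1 ≤ R) (hRK : 2 * R + 2 ≤ K) (u : ℝ) :
    ∫ s : ℝ, chainIntegrand A B C x y ε K (u, s) =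
      fiberIntegral A B C x y ε (u + contourHeight K u * Complex.I) *
        (1 + contourSlope K u * Complex.I) := by
  have hA := abs_nonneg A
  have hB := abs_nonneg B
  have hC := abs_nonneg C
  have hK : 0 < K := by linarith
  change _ = fiberIntegral A B C x y ε (contour K u) * _
  have hsq := fiberDir_sq hK u
  have hμn := norm_fiberDir_sq_le hK u
  obtain ⟨hμre, hμim⟩ := abs_im_fiberDir_le hK u
  have hsl := I_mul_contour_mem_slitPlane hK u
  set ζ := contour K u with hζ
  set μ := fiberDir K u with hμ
  set w : ℂ := ε + Complex.I * (C + 3 * ζ) with hw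
  set v : ℂ := w * μ ^ 2 with hv
  have hμ0 : μ ≠ 0 := fun h => by rw [h] at hμre; simp at hμre
  have ev : v = 3 + (ε + Complex.I * C) * μ ^ 2 := by
    rw [hv, hw]; linear_combination 3 * hsq
  -- `K` is large enough that the lower order terms move the Gaussian exponent by at most `1`
  have hv3 : ‖v - 3‖ ≤ 1 := by
    rw [ev, add_sub_cancel_left, norm_mul, norm_pow]
    have h1 : ‖(ε : ℂ) + Complex.I * C‖ ≤ R := by
      refine (norm_add_le _ _).trans ?_
      rw [norm_mul, Complex.norm_I, one_mul, Complex.norm_real, Complex.norm_real,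
        Real.norm_eq_abs, Real.norm_eq_abs, abs_of_nonneg hε]
      linarith
    have hR0 : 0 ≤ R := by linarith
    calc _ ≤ R * (2 / K) := by gcongr
      _ ≤ 1 := by rw [← mul_div_assoc, div_le_one hK]; linarith
  obtain ⟨hvs, hrre, hrim⟩ := abs_im_cpow_half_le hv3
  have hv0 := Complex.slitPlane_ne_zero hvs
  have hw0 : w ≠ 0 := fun h => hv0 (by rw [hv, h, zero_mul])
  have hvre : (-v).re < 0 := by
    have := (Complex.abs_re_le_norm (v - 3)).trans hv3
    simp at this ⊢
    linarith [(abs_le.1 this).1]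
  have hws : w ∈ Complex.slitPlane := by
    rw [Complex.mem_slitPlane_iff]
    by_cases him : w.im = 0
    · left
      have him' : C + 3 * u = 0 := by simpa [hw, hζ, contour] using him
      have hu : |u| ≤ K := by
        have : u = -C / 3 := by linarith
        rw [this, abs_div, abs_neg, abs_of_pos (by norm_num : (0:ℝ) < 3)]
        linarith
      have hh := contourHeight_nonpos hK hu
      have hre : w.re = ε - 3 * contourHeight K u := by simp [hw, hζ, contour]; ring
      have h0 : 0 ≤ w.re := by rw [hre]; linarith
      refine lt_of_le_of_ne h0 fun h => hw0 (Complex.ext h.symm him)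
    · exact Or.inr him
  -- the principal roots match: no branch cut is crossed in passing to the rotated line
  have hroot : (Real.pi / w : ℂ) ^ (1 / 2 : ℂ) = μ * (Real.pi / v : ℂ) ^ (1 / 2 : ℂ) := by
    refine eq_mul_of_sq_eq ?_ (re_cpow_half_pos (pi_div_mem_slitPlane hws)) hμre hrre hμim hrim
    rw [mul_pow, cpow_half_sq, cpow_half_sq, hv]
    field_simp
  have h := integral_cexp_quadratic hvre (-Complex.I * (y + B * ζ) * μ)
    (Complex.I * ζ ^ 3 - (ε + Complex.I * A) * ζ ^ 2 - Complex.I * x * ζ)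
  rw [neg_neg] at h
  have hfun : ∀ s : ℝ, chainIntegrand A B C x y ε K (u, s) = (μ * (1 + contourSlope K u * Complex.I))
      * Complex.exp (-v * s ^ 2 + -Complex.I * (y + B * ζ) * μ * s +
        (Complex.I * ζ ^ 3 - (ε + Complex.I * A) * ζ ^ 2 - Complex.I * x * ζ)) := fun s => by
    simp only [chainIntegrand, chainWeight, chainXi, chainEta, ← hζ, ← hμ]
    have hcomm : ∀ a b c d : ℂ, a * b * c * d = b * c * (a * d) := fun a b c d => by ring
    rw [ev, hcomm, ← Complex.exp_add]
    congr 2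
    ring
  simp only [hfun]
  rw [integral_const_mul, h, fiberIntegral, ← hw, hroot]
  have hexp : Complex.I * ζ ^ 3 - (ε + Complex.I * A) * ζ ^ 2 - Complex.I * x * ζ -
      (-Complex.I * (y + B * ζ) * μ) ^ 2 / (4 * -v) =
      Complex.I * ζ ^ 3 - (ε + Complex.I * A) * ζ ^ 2 - Complex.I * x * ζ -
        (y + B * ζ) ^ 2 / (4 * w) := by
    rw [hv]
    have hI : Complex.I ^ 2 = -1 := Complex.I_sq
    congr 1
    rw [div_eq_div_iff (by simp [hw0, hμ0]) (by simp [hw0])]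
    linear_combination ((y : ℂ) + B * ζ) ^ 2 * μ ^ 2 * 4 * w * hI
  rw [hexp]
  ring

theorem norm_chainExponent_le {ε R : ℝ} (hε : 0 ≤ ε) (hε1 : ε ≤ 1)
    (hR : |A| + |B| + |C| + 1 ≤ R) (Z N : ℂ) :
    ‖-Complex.I * (x * Z + y * N) - Complex.I * (A * Z ^ 2 + B * (Z * N) + C * N ^ 2) -
      ε * (Z ^ 2 + N ^ 2)‖ ≤ (|x| + |y|) * (‖Z‖ + ‖N‖) + R * (‖Z‖ ^ 2 + ‖N‖ ^ 2) := by
  have hZ := norm_nonneg Z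
  have hN := norm_nonneg N
  have h1 : ‖-Complex.I * (x * Z + y * N)‖ ≤ |x| * ‖Z‖ + |y| * ‖N‖ := by
    rw [norm_mul, norm_neg, Complex.norm_I, one_mul]
    refine (norm_add_le _ _).trans_eq ?_
    simp
  have h2 : ‖Complex.I * (A * Z ^ 2 + B * (Z * N) + C * N ^ 2)‖ ≤
      |A| * ‖Z‖ ^ 2 + |B| * (‖Z‖ * ‖N‖) + |C| * ‖N‖ ^ 2 := by
    rw [norm_mul, Complex.norm_I, one_mul]
    refine (norm_add₃_le).trans_eq ?_
    simp
  have h3 : ‖(ε : ℂ) * (Z ^ 2 + N ^ 2)‖ ≤ 1 * (‖Z‖ ^ 2 + ‖N‖ ^ 2) := by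
    rw [norm_mul, Complex.norm_real, Real.norm_of_nonneg hε]
    gcongr
    refine (norm_add_le _ _).trans_eq ?_
    simp
  have h4 : ‖Z‖ * ‖N‖ ≤ ‖Z‖ ^ 2 + ‖N‖ ^ 2 := by nlinarith [sq_nonneg (‖Z‖ - ‖N‖)]
  have h5 : |B| * (‖Z‖ * ‖N‖) ≤ |B| * (‖Z‖ ^ 2 + ‖N‖ ^ 2) := by gcongr
  have h6 : (|A| + |B| + |C| + 1) * (‖Z‖ ^ 2 + ‖N‖ ^ 2) ≤ R * (‖Z‖ ^ 2 + ‖N‖ ^ 2) := by gcongr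
  have h7 := mul_nonneg (abs_nonneg A) (sq_nonneg ‖N‖)
  have h8 := mul_nonneg (abs_nonneg C) (sq_nonneg ‖Z‖)
  have h9 := mul_nonneg (abs_nonneg x) hN
  have h10 := mul_nonneg (abs_nonneg y) hZ
  refine (norm_sub_le _ _).trans ?_
  have := norm_sub_le (-Complex.I * (x * Z + y * N))
    (Complex.I * (A * Z ^ 2 + B * (Z * N) + C * N ^ 2))
  nlinarith

theorem norm_chainIntegrand_le {ε K R : ℝ} (hε : 0 ≤ ε) (hε1 : ε ≤ 1)
    (hR : |A| + |B| + |C| + 1 ≤ R) (p : ℝ × ℝ) :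
    ‖chainIntegrand A B C x y ε K p‖ ≤
      Real.exp ((|x| + |y|) * (‖chainXi K p‖ + ‖chainEta K p‖) +
        R * (‖chainXi K p‖ ^ 2 + ‖chainEta K p‖ ^ 2)) * ‖chainWeight K p‖ := by
  rw [chainIntegrand, norm_mul, mul_comm]
  gcongr
  exact (Complex.norm_exp_le_exp_norm _).trans
    (Real.exp_le_exp.2 (norm_chainExponent_le A B C x y hε hε1 hR _ _))

theorem continuous_chainIntegrand {K : ℝ} (hK : 0 < K) :
    Continuous (fun q : ℝ × ℝ × ℝ => chainIntegrand A B C x y q.1 K q.2) := by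
  have h1 := (continuous_chainXi hK).comp (continuous_snd (X := ℝ) (Y := ℝ × ℝ))
  have h2 := (continuous_chainEta hK).comp (continuous_snd (X := ℝ) (Y := ℝ × ℝ))
  have h3 := (continuous_chainWeight hK).comp (continuous_snd (X := ℝ) (Y := ℝ × ℝ))
  simp only [Function.comp_def] at h1 h2 h3
  unfold chainIntegrand
  fun_prop

theorem aestronglyMeasurable_chainIntegrand {K : ℝ} (hK : 0 < K) (ε : ℝ) :
    AEStronglyMeasurable (chainIntegrand A B C x y ε K) volume := by
  have h : Continuous (fun p : ℝ × ℝ => (ε, p)) := by fun_prop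
  have := (continuous_chainIntegrand A B C x y hK).comp h
  exact this.aestronglyMeasurable

theorem integrable_chainIntegrand {ε K R : ℝ} (hε : 0 ≤ ε) (hε1 : ε ≤ 1)
    (hR : |A| + |B| + |C| + 1 ≤ R) (hRK : 2 * R + 2 ≤ K) :
    Integrable (chainIntegrand A B C x y ε K) := by
  have hR0 : 0 ≤ R := by linarith [abs_nonneg A, abs_nonneg B, abs_nonneg C]
  exact (integrable_exp_mul_norm_chainWeight hR0 hRK (|x| + |y|)).mono'
    (aestronglyMeasurable_chainIntegrand A B C x y (by linarith) ε)
    (Eventually.of_forall fun p => norm_chainIntegrand_le A B C x y hε hε1 hR p)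

theorem tendsto_exp_linear_sub_sq {ε : ℝ} (hε : 0 < ε) (a b c : ℝ) :
    Tendsto (fun t : ℝ => a * Real.exp (b + c * t - ε * t ^ 2)) atTop (𝓝 0) := by
  have h1 : Tendsto (fun t : ℝ => ε * t - c) atTop atTop :=
    tendsto_atTop_add_const_right _ _ (tendsto_id.const_mul_atTop hε)
  have h2 : Tendsto (fun t : ℝ => -(t * (ε * t - c)) + b) atTop atBot :=
    tendsto_atBot_add_const_right _ _ (tendsto_neg_atTop_atBot.comp (tendsto_id.atTop_mul_atTop₀ h1))
  have h3 := (Real.tendsto_exp_atBot.comp h2).const_mul a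
  rw [mul_zero] at h3
  refine h3.congr fun t => ?_
  simp only [Function.comp_def]
  ring_nf

/-- Far out, and between the real axis and the contour, the fibre integral decays like a Gaussian in
`Re ζ`. -/
theorem norm_fiberIntegral_le {ε K : ℝ} (hε : 0 ≤ ε) {u t : ℝ} (ht0 : 0 ≤ t)
    (htK : t ≤ K) (hu1 : 1 ≤ |u|) (huC : |C| ≤ |u|) (huK : K ≤ |u|) :
    ‖fiberIntegral A B C x y ε (u + t * Complex.I)‖ ≤
      2 * Real.exp (K ^ 3 + ε * K ^ 2 + |x| * K +
        (2 * |A| * K + (|y| + 2 * |B|) ^ 2 / 4) * |u| - ε * |u| ^ 2) := by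
  set ζ : ℂ := u + t * Complex.I with hζ
  set w : ℂ := ε + Complex.I * (C + 3 * ζ) with hw
  have hw1 : |u| ≤ ‖w‖ := by
    have h1 : w.im = C + 3 * u := by simp [hw, hζ]
    have h2 := Complex.abs_im_le_norm w
    rw [h1] at h2
    have h3 : |3 * u| ≤ |C + 3 * u| + |C| := by
      have := abs_sub (C + 3 * u) C
      rwa [add_sub_cancel_left] at this
    rw [abs_mul, abs_of_pos (by norm_num : (0:ℝ) < 3)] at h3
    linarith
  have hw0 : 0 < ‖w‖ := by linarith
  have hroot : ‖(Real.pi / w : ℂ) ^ (1 / 2 : ℂ)‖ ≤ 2 := by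
    have h1 : ‖(Real.pi / w : ℂ) ^ (1 / 2 : ℂ)‖ ^ 2 ≤ 2 ^ 2 := by
      rw [← norm_pow, cpow_half_sq, norm_div, Complex.norm_real, Real.norm_of_nonneg Real.pi_pos.le]
      rw [div_le_iff₀ hw0]
      linarith [Real.pi_le_four]
    exact (pow_le_pow_iff_left₀ (norm_nonneg _) (by norm_num) two_ne_zero).1 h1
  have hζn : ‖ζ‖ ≤ 2 * |u| := by
    rw [hζ]
    refine (norm_add_le _ _).trans ?_
    rw [norm_mul, Complex.norm_I, mul_one, Complex.norm_real, Complex.norm_real, Real.norm_eq_abs,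
      Real.norm_eq_abs, abs_of_nonneg ht0]
    linarith
  have hquot : ‖(y + B * ζ) ^ 2 / (4 * w)‖ ≤ (|y| + 2 * |B|) ^ 2 / 4 * |u| := by
    have h1 : ‖(y : ℂ) + B * ζ‖ ≤ (|y| + 2 * |B|) * |u| := by
      refine (norm_add_le _ _).trans ?_
      rw [norm_mul, Complex.norm_real, Complex.norm_real, Real.norm_eq_abs, Real.norm_eq_abs]
      have h2 : |B| * ‖ζ‖ ≤ |B| * (2 * |u|) := by gcongr
      have h3 : |y| * 1 ≤ |y| * |u| := by gcongr
      linarith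
    rw [norm_div, norm_pow, norm_mul, div_le_iff₀ (by simpa using hw0)]
    calc ‖(y : ℂ) + B * ζ‖ ^ 2 ≤ ((|y| + 2 * |B|) * |u|) ^ 2 := by gcongr
      _ = (|y| + 2 * |B|) ^ 2 / 4 * |u| * (4 * |u|) := by ring
      _ ≤ (|y| + 2 * |B|) ^ 2 / 4 * |u| * (‖(4 : ℂ)‖ * ‖w‖) := by
          gcongr
          simp
  have e1 : (Complex.I * ζ ^ 3).re = -3 * u ^ 2 * t + t ^ 3 := by
    simp [hζ, pow_succ]; ring
  have e2 : ((ε + Complex.I * A) * ζ ^ 2).re = ε * (u ^ 2 - t ^ 2) - 2 * A * u * t := by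
    simp [hζ, pow_succ]; ring
  have e3 : (Complex.I * x * ζ).re = -x * t := by simp [hζ]
  have e4 : -((y + B * ζ) ^ 2 / (4 * w)).re ≤ (|y| + 2 * |B|) ^ 2 / 4 * |u| :=
    (neg_le_abs _).trans ((Complex.abs_re_le_norm _).trans hquot)
  rw [fiberIntegral, ← hw, norm_mul, Complex.norm_exp]
  gcongr
  rw [Complex.sub_re, Complex.sub_re, Complex.sub_re, e1, e2, e3]
  have b1 : t ^ 3 ≤ K ^ 3 := by gcongr
  have b2 : ε * t ^ 2 ≤ ε * K ^ 2 := by gcongr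
  have b3 : x * t ≤ |x| * K := by
    calc x * t ≤ |x| * t := by gcongr; exact le_abs_self x
      _ ≤ _ := by gcongr
  have b4 : A * u * t ≤ |A| * |u| * K := by
    calc A * u * t ≤ |A * u| * t := by gcongr; exact le_abs_self _
      _ ≤ _ := by rw [abs_mul]; gcongr
  have b5 : 0 ≤ u ^ 2 * t := by positivity
  have b6 := sq_abs u
  rw [b6]
  nlinarith

/-- For a positive regularization, the plane integral equals the integral over the chain. -/
theorem integral_regIntegrand_eq_integral_chain {ε K R : ℝ} (hε : 0 < ε) (hε1 : ε ≤ 1)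
    (hR : |A| + |B| + |C| + 1 ≤ R) (hRK : 2 * R + 2 ≤ K) :
    ∫ p : ℝ × ℝ, regIntegrand A B C x y ε p.1 p.2 = ∫ p, chainIntegrand A B C x y ε K p := by
  have hA := abs_nonneg A
  have hB := abs_nonneg B
  have hC := abs_nonneg C
  have hK : 0 < K := by linarith
  obtain ⟨hint₀, e0⟩ := integral_plane_regIntegrand A B C x y hε
  have hchain := integrable_chainIntegrand A B C x y hε.le hε1 hR hRK
  rw [Measure.volume_eq_prod] at hchain
  have hint₁ := hchain.integral_prod_left
  have e1 := integral_prod _ hchain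
  rw [← Measure.volume_eq_prod] at e1
  simp only [integral_chainIntegrand_fiber A B C x y hε.le hε1 hR hRK] at hint₁ e1
  rw [e0, e1]
  set N : ℝ → ℝ := fun t => 2 * K * Real.exp (K ^ 3 + ε * K ^ 2 + |x| * K +
        (2 * |A| * K + (|y| + 2 * |B|) ^ 2 / 4) * t - ε * t ^ 2) with hN
  have hNlim : Tendsto N atTop (𝓝 0) := tendsto_exp_linear_sub_sq hε _ _ _
  refine integral_eq_integral_contour (U := {ζ : ℂ | ε + Complex.I * (C + 3 * ζ) ∈
      Complex.slitPlane}) (M := fun u => N |u|) (R₀ := K) ?_ ?_ (hasDerivAt_contourHeight hK)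
      (continuous_contourSlope hK) ?_ hint₀ hint₁ ?_ (hNlim.comp tendsto_abs_atBot_atTop)
      (hNlim.comp tendsto_abs_atTop_atTop)
  · exact Complex.isOpen_slitPlane.preimage (by fun_prop)
  · intro ζ hζ
    have hs := pi_div_mem_slitPlane hζ
    have h0 := Complex.slitPlane_ne_zero hζ
    refine DifferentiableAt.differentiableWithinAt ?_
    have hd : DifferentiableAt ℂ (fun z : ℂ => (ε : ℂ) + Complex.I * (C + 3 * z)) ζ := by fun_prop
    unfold fiberIntegral
    refine DifferentiableAt.mul ?_ (DifferentiableAt.cexp ?_)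
    · exact ((differentiableAt_const (Real.pi : ℂ)).div hd h0).cpow_const hs
    · exact DifferentiableAt.sub (by fun_prop)
        ((by fun_prop : DifferentiableAt ℂ (fun z : ℂ => ((y : ℂ) + B * z) ^ 2) ζ).div
          (hd.const_mul 4) (mul_ne_zero (by norm_num) h0))
  · intro u s hs
    rw [Set.mem_ofPred_eq, Complex.mem_slitPlane_iff]
    by_cases him : C + 3 * u = 0
    · left
      have hu : |u| ≤ K := by
        have : u = -C / 3 := by linarith
        rw [this, abs_div, abs_neg, abs_of_pos (by norm_num : (0:ℝ) < 3)]
        linarith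
      have hh := contourHeight_nonpos hK hu
      have : s * contourHeight K u ≤ 0 := mul_nonpos_of_nonneg_of_nonpos hs.1 hh
      simp
      linarith
    · right
      simpa using him
  · intro u hu s hs
    have hh := contourHeight_nonneg hK hu
    have hhK := (abs_le.1 (abs_contourHeight_le hK u)).2
    have ht0 : 0 ≤ s * contourHeight K u := mul_nonneg hs.1 hh
    have htK : s * contourHeight K u ≤ K := by nlinarith [hs.2]
    have := norm_fiberIntegral_le A B C x y hε.le ht0 htK (by linarith) (by linarith) hu
    push_cast at this
    rw [norm_mul, Complex.norm_real, Real.norm_of_nonneg hh]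
    calc _ ≤ _ * K := mul_le_mul this hhK hh (by positivity)
      _ = N |u| := by rw [hN]; ring

/-- The improper integral over rectangles equals the absolutely convergent integral over the
chain. -/
theorem tendsto_integral_rect_chain {K R : ℝ}
    (hR : |A| + |B| + |C| + 1 ≤ R) (hRK : 2 * R + 2 ≤ K) :
    Tendsto (fun r : (ℝ × ℝ) × (ℝ × ℝ) =>
      ∫ ξ in r.1.1..r.1.2, ∫ η in r.2.1..r.2.2, regIntegrand A B C x y 0 ξ η)
      exhaustPlane (𝓝 (∫ p, chainIntegrand A B C x y 0 K p)) := by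
  have hR0 : 0 ≤ R := by linarith [abs_nonneg A, abs_nonneg B, abs_nonneg C]
  have hK : 0 < K := by linarith
  obtain ⟨L, hL, hreg⟩ := exists_tendsto_integral_rect_and_regularized A B C x y
  have hev : ∀ᶠ ε in 𝓝[>] (0 : ℝ), 0 < ε ∧ ε ≤ 1 :=
    mem_of_superset (Ioc_mem_nhdsGT zero_lt_one) fun ε h => ⟨h.1, h.2⟩
  have hlim : Tendsto (fun ε => ∫ p, chainIntegrand A B C x y ε K p) (𝓝[>] 0)
      (𝓝 (∫ p, chainIntegrand A B C x y 0 K p)) := by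
    refine tendsto_integral_filter_of_dominated_convergence _
      (Eventually.of_forall fun ε => aestronglyMeasurable_chainIntegrand A B C x y hK ε)
      (hev.mono fun ε h => Eventually.of_forall fun p =>
        norm_chainIntegrand_le A B C x y h.1.le h.2 hR p)
      (integrable_exp_mul_norm_chainWeight hR0 hRK (|x| + |y|)) (Eventually.of_forall fun p => ?_)
    have h : Continuous (fun ε : ℝ => (ε, p)) := by fun_prop
    have := ((continuous_chainIntegrand A B C x y hK).comp h).tendsto 0
    simp only [Function.comp_def] at this
    exact this.mono_left nhdsWithin_le_nhds
  have hEq : L = ∫ p, chainIntegrand A B C x y 0 K p := by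
    refine tendsto_nhds_unique hreg (hlim.congr' (hev.mono fun ε h => ?_))
    exact (integral_regIntegrand_eq_integral_chain A B C x y h.1 h.2 hR hRK).symm
  rwa [← hEq]

end Fiber

/-! ### Superpositions of complex plane waves -/

theorem norm_planeWave_le {T : Type*} {Z N : T → ℂ} (W : T → ℂ) {x y r : ℝ} (hx : |x| ≤ r) (hy : |y| ≤ r) (τ : T) :
    ‖W τ * Complex.exp (-Complex.I * (x * Z τ + y * N τ))‖ ≤
      Real.exp (r * (‖Z τ‖ + ‖N τ‖)) * ‖W τ‖ := by
  rw [norm_mul, mul_comm]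
  gcongr
  refine (Complex.norm_exp_le_exp_norm _).trans (Real.exp_le_exp.2 ?_)
  rw [norm_mul, norm_neg, Complex.norm_I, one_mul]
  refine (norm_add_le _ _).trans ?_
  rw [norm_mul, norm_mul, Complex.norm_real, Complex.norm_real, Real.norm_eq_abs,
    Real.norm_eq_abs, mul_add]
  gcongr

section PlaneWave

variable {T : Type*} [MeasurableSpace T] (m : Measure T) (Z N : T → ℂ)

/-- The superposition `∫ W(τ) exp (-i (x Z(τ) + y N(τ))) dm(τ)` of plane waves with complex wave
vectors `(Z, N)`. -/
noncomputable def planeWaves (W : T → ℂ) (x y : ℝ) : ℂ :=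
  ∫ τ, W τ * Complex.exp (-Complex.I * (x * Z τ + y * N τ)) ∂m

/-- All exponential moments of `W` along the wave vectors `(Z, N)` are finite. -/
structure ExpMoments (W : T → ℂ) : Prop where
  aestronglyMeasurable : AEStronglyMeasurable W m
  integrable : ∀ r : ℝ, Integrable (fun τ => Real.exp (r * (‖Z τ‖ + ‖N τ‖)) * ‖W τ‖) m

variable {m Z N}

theorem ExpMoments.mul {W P : T → ℂ} (hW : ExpMoments m Z N W) (hP : AEStronglyMeasurable P m)
    {c k : ℝ} (hPb : ∀ τ, ‖P τ‖ ≤ c * Real.exp (k * (‖Z τ‖ + ‖N τ‖)))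
    (hZ : AEStronglyMeasurable Z m) (hN : AEStronglyMeasurable N m) :
    ExpMoments m Z N (fun τ => P τ * W τ) := by
  refine ⟨hP.mul hW.1, fun r => ?_⟩
  refine ((hW.2 (r + k)).const_mul c).mono' ?_ (Eventually.of_forall fun τ => ?_)
  · exact (Real.continuous_exp.comp_aestronglyMeasurable
      ((hZ.norm.add hN.norm).const_mul r)).mul (hP.mul hW.1).norm
  · rw [Real.norm_of_nonneg (by positivity), norm_mul, add_mul, Real.exp_add]
    calc _ ≤ Real.exp (r * (‖Z τ‖ + ‖N τ‖)) *
          (c * Real.exp (k * (‖Z τ‖ + ‖N τ‖)) * ‖W τ‖) := by gcongr; exact hPb τ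
      _ = _ := by ring

theorem ExpMoments.linear_mul {W : T → ℂ} (hW : ExpMoments m Z N W)
    (hZ : AEStronglyMeasurable Z m) (hN : AEStronglyMeasurable N m) (a b : ℂ) :
    ExpMoments m Z N (fun τ => (a * Z τ + b * N τ) * W τ) := by
  refine hW.mul ((hZ.const_mul a).add (hN.const_mul b)) (c := ‖a‖ + ‖b‖) (k := 1) (fun τ => ?_) hZ hN
  have h1 := Real.add_one_le_exp (1 * (‖Z τ‖ + ‖N τ‖))
  have hz := norm_nonneg (Z τ)
  have hn := norm_nonneg (N τ)
  calc ‖a * Z τ + b * N τ‖ ≤ ‖a‖ * ‖Z τ‖ + ‖b‖ * ‖N τ‖ := by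
        rw [← norm_mul, ← norm_mul]; exact norm_add_le _ _
    _ ≤ ‖a‖ * Real.exp (1 * (‖Z τ‖ + ‖N τ‖)) + ‖b‖ * Real.exp (1 * (‖Z τ‖ + ‖N τ‖)) := by
        gcongr <;> linarith
    _ = _ := by ring

theorem ExpMoments.exp_linear_mul {W : T → ℂ} (hW : ExpMoments m Z N W)
    (hZ : AEStronglyMeasurable Z m) (hN : AEStronglyMeasurable N m) (c d : ℝ) :
    ExpMoments m Z N (fun τ => Complex.exp (-Complex.I * (c * Z τ + d * N τ)) * W τ) := by
  refine hW.mul (c := 1) (k := |c| + |d|) ?_ (fun τ => ?_) hZ hN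
  · exact Complex.continuous_exp.comp_aestronglyMeasurable
      (((hZ.const_mul (c : ℂ)).add (hN.const_mul (d : ℂ))).const_mul (-Complex.I))
  · refine (Complex.norm_exp_le_exp_norm _).trans ?_
    rw [one_mul]
    gcongr
    rw [norm_mul, norm_neg, Complex.norm_I, one_mul]
    refine (norm_add_le _ _).trans ?_
    rw [norm_mul, norm_mul, Complex.norm_real, Complex.norm_real, Real.norm_eq_abs,
      Real.norm_eq_abs]
    nlinarith [mul_nonneg (abs_nonneg c) (norm_nonneg (N τ)),
      mul_nonneg (abs_nonneg d) (norm_nonneg (Z τ))]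

theorem aestronglyMeasurable_planeWave {W : T → ℂ} (hW : AEStronglyMeasurable W m)
    (hZ : AEStronglyMeasurable Z m) (hN : AEStronglyMeasurable N m) (x y : ℝ) :
    AEStronglyMeasurable (fun τ => W τ * Complex.exp (-Complex.I * (x * Z τ + y * N τ))) m :=
  hW.mul (Complex.continuous_exp.comp_aestronglyMeasurable
    (((hZ.const_mul (x : ℂ)).add (hN.const_mul (y : ℂ))).const_mul (-Complex.I)))

theorem ExpMoments.integrable_planeWave {W : T → ℂ} (hW : ExpMoments m Z N W)
    (hZ : AEStronglyMeasurable Z m) (hN : AEStronglyMeasurable N m) (x y : ℝ) :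
    Integrable (fun τ => W τ * Complex.exp (-Complex.I * (x * Z τ + y * N τ))) m :=
  (hW.2 (|x| + |y|)).mono' (aestronglyMeasurable_planeWave hW.1 hZ hN x y)
    (Eventually.of_forall fun τ => norm_planeWave_le W (by linarith [abs_nonneg y])
      (by linarith [abs_nonneg x]) τ)

theorem ExpMoments.hasFDerivAt {W : T → ℂ} (hW : ExpMoments m Z N W)
    (hZ : AEStronglyMeasurable Z m) (hN : AEStronglyMeasurable N m) (p : ℝ × ℝ) :
    HasFDerivAt (fun q : ℝ × ℝ => planeWaves m Z N W q.1 q.2)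
      (planeWaves m Z N (fun τ => (-Complex.I * Z τ) * W τ) p.1 p.2 •
          (Complex.ofRealCLM.comp (ContinuousLinearMap.fst ℝ ℝ ℝ)) +
        planeWaves m Z N (fun τ => (-Complex.I * N τ) * W τ) p.1 p.2 •
          (Complex.ofRealCLM.comp (ContinuousLinearMap.snd ℝ ℝ ℝ))) p := by
  set L₁ : ℝ × ℝ →L[ℝ] ℂ := Complex.ofRealCLM.comp (ContinuousLinearMap.fst ℝ ℝ ℝ) with hL₁
  set L₂ : ℝ × ℝ →L[ℝ] ℂ := Complex.ofRealCLM.comp (ContinuousLinearMap.snd ℝ ℝ ℝ) with hL₂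
  have hWZ : ExpMoments m Z N (fun τ => (-Complex.I * Z τ) * W τ) := by
    simpa using hW.linear_mul hZ hN (-Complex.I) 0
  have hWN : ExpMoments m Z N (fun τ => (-Complex.I * N τ) * W τ) := by
    simpa using hW.linear_mul hZ hN 0 (-Complex.I)
  set r : ℝ := ‖p‖ + 1 with hr
  have hball : ∀ q ∈ Metric.ball p 1, |q.1| ≤ r ∧ |q.2| ≤ r := fun q hq => by
    have h1 : ‖q‖ ≤ r := by
      have := norm_add_le (q - p) p
      rw [sub_add_cancel] at this
      have h2 : ‖q - p‖ < 1 := by simpa [dist_eq_norm] using hq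
      linarith
    exact ⟨(norm_fst_le q).trans h1, (norm_snd_le q).trans h1⟩
  have i₁ := (hWZ.integrable_planeWave hZ hN p.1 p.2)
  have i₂ := (hWN.integrable_planeWave hZ hN p.1 p.2)
  have key := hasFDerivAt_integral_of_dominated_of_fderiv_le (𝕜 := ℝ) (μ := m)
    (F := fun (q : ℝ × ℝ) τ => W τ * Complex.exp (-Complex.I * (q.1 * Z τ + q.2 * N τ)))
    (F' := fun (q : ℝ × ℝ) τ =>
      ((-Complex.I * Z τ) * W τ * Complex.exp (-Complex.I * (q.1 * Z τ + q.2 * N τ))) • L₁ +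
      ((-Complex.I * N τ) * W τ * Complex.exp (-Complex.I * (q.1 * Z τ + q.2 * N τ))) • L₂)
    (bound := fun τ => Real.exp (r * (‖Z τ‖ + ‖N τ‖)) * ‖(-Complex.I * Z τ) * W τ‖ * ‖L₁‖ +
      Real.exp (r * (‖Z τ‖ + ‖N τ‖)) * ‖(-Complex.I * N τ) * W τ‖ * ‖L₂‖)
    (x₀ := p) (s := Metric.ball p 1) (Metric.ball_mem_nhds p one_pos)
    (Eventually.of_forall fun q => aestronglyMeasurable_planeWave hW.1 hZ hN q.1 q.2)
    (hW.integrable_planeWave hZ hN p.1 p.2)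
    ((i₁.smul_const L₁).add (i₂.smul_const L₂)).aestronglyMeasurable
    (Eventually.of_forall fun τ q hq => ?_)
    (((hWZ.2 r).mul_const _).add ((hWN.2 r).mul_const _))
    (Eventually.of_forall fun τ q _ => ?_)
  · have e : ∫ τ, (((-Complex.I * Z τ) * W τ *
        Complex.exp (-Complex.I * (p.1 * Z τ + p.2 * N τ))) • L₁ + ((-Complex.I * N τ) * W τ *
        Complex.exp (-Complex.I * (p.1 * Z τ + p.2 * N τ))) • L₂) ∂m =
        planeWaves m Z N (fun τ => (-Complex.I * Z τ) * W τ) p.1 p.2 • L₁ +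
        planeWaves m Z N (fun τ => (-Complex.I * N τ) * W τ) p.1 p.2 • L₂ := by
      rw [integral_add (i₁.smul_const L₁) (i₂.smul_const L₂), integral_smul_const,
        integral_smul_const]
      rfl
    rw [← e]
    exact key
  · obtain ⟨h1, h2⟩ := hball q hq
    refine (norm_add_le _ _).trans ?_
    rw [norm_smul, norm_smul]
    gcongr
    · exact norm_planeWave_le (fun τ => (-Complex.I * Z τ) * W τ) h1 h2 τ
    · exact norm_planeWave_le (fun τ => (-Complex.I * N τ) * W τ) h1 h2 τ
  · have d1 : HasFDerivAt (fun q : ℝ × ℝ => ((q.1 : ℝ) : ℂ)) L₁ q := L₁.hasFDerivAt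
    have d2 : HasFDerivAt (fun q : ℝ × ℝ => ((q.2 : ℝ) : ℂ)) L₂ q := L₂.hasFDerivAt
    have d3 := ((((d1.mul_const (Z τ)).add (d2.mul_const (N τ))).const_mul
      (-Complex.I)).cexp).const_mul (W τ)
    refine d3.congr_fderiv ?_
    ext <;> simp <;> ring

theorem ExpMoments.partialX_eq {W : T → ℂ} (hW : ExpMoments m Z N W)
    (hZ : AEStronglyMeasurable Z m) (hN : AEStronglyMeasurable N m) :
    partialX (planeWaves m Z N W) = planeWaves m Z N (fun τ => (-Complex.I * Z τ) * W τ) := by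
  funext x y
  have hline : HasDerivAt (fun s : ℝ => (s, y)) ((1 : ℝ), (0 : ℝ)) x :=
    (hasDerivAt_id x).prodMk (hasDerivAt_const x y)
  have h := (hW.hasFDerivAt hZ hN (x, y)).comp_hasDerivAt x hline
  rw [partialX]
  refine (h.deriv).trans ?_
  simp

theorem ExpMoments.partialY_eq {W : T → ℂ} (hW : ExpMoments m Z N W)
    (hZ : AEStronglyMeasurable Z m) (hN : AEStronglyMeasurable N m) :
    partialY (planeWaves m Z N W) = planeWaves m Z N (fun τ => (-Complex.I * N τ) * W τ) := by
  funext x y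
  have hline : HasDerivAt (fun s : ℝ => (x, s)) ((0 : ℝ), (1 : ℝ)) y :=
    (hasDerivAt_const y x).prodMk (hasDerivAt_id y)
  have h := (hW.hasFDerivAt hZ hN (x, y)).comp_hasDerivAt y hline
  rw [partialY]
  refine (h.deriv).trans ?_
  simp

theorem ExpMoments.contDiff_nat (hZ : AEStronglyMeasurable Z m) (hN : AEStronglyMeasurable N m)
    (n : ℕ) : ∀ {W : T → ℂ}, ExpMoments m Z N W →
      ContDiff ℝ n (fun p : ℝ × ℝ => planeWaves m Z N W p.1 p.2) := by
  induction n with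
  | zero =>
    intro W hW
    exact contDiff_zero.2 (continuous_iff_continuousAt.2 fun p =>
      (hW.hasFDerivAt hZ hN p).continuousAt)
  | succ n ih =>
    intro W hW
    have hWZ : ExpMoments m Z N (fun τ => (-Complex.I * Z τ) * W τ) := by
      simpa using hW.linear_mul hZ hN (-Complex.I) 0
    have hWN : ExpMoments m Z N (fun τ => (-Complex.I * N τ) * W τ) := by
      simpa using hW.linear_mul hZ hN 0 (-Complex.I)
    push_cast
    exact contDiff_succ_iff_hasFDerivAt.2 ⟨_, ((ih hWZ).smul contDiff_const).add
      ((ih hWN).smul contDiff_const), fun p => hW.hasFDerivAt hZ hN p⟩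

theorem ExpMoments.contDiff {W : T → ℂ} (hW : ExpMoments m Z N W)
    (hZ : AEStronglyMeasurable Z m) (hN : AEStronglyMeasurable N m) :
    ContDiff ℝ ∞ (fun p : ℝ × ℝ => planeWaves m Z N W p.1 p.2) :=
  contDiff_infty.2 fun n => ExpMoments.contDiff_nat hZ hN n hW

theorem ExpMoments.quad_mul {W : T → ℂ} (hW : ExpMoments m Z N W)
    (hZ : AEStronglyMeasurable Z m) (hN : AEStronglyMeasurable N m) (α β γ : ℝ) :
    ExpMoments m Z N (fun τ => -(α * Z τ ^ 2 + β * (Z τ * N τ) + γ * N τ ^ 2) * W τ) := by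
  set M : ℝ := |α| + |β| + |γ| with hM
  refine hW.mul (c := 2 * M) (k := 1) ?_ (fun τ => ?_) hZ hN
  · exact ((((hZ.pow 2).const_mul _).add ((hZ.mul hN).const_mul _)).add
      ((hN.pow 2).const_mul _)).neg
  · have hz := norm_nonneg (Z τ)
    have hn := norm_nonneg (N τ)
    have h1 := Real.quadratic_le_exp_of_nonneg (by positivity : 0 ≤ 1 * (‖Z τ‖ + ‖N τ‖))
    have h2 : ‖-((α : ℂ) * Z τ ^ 2 + β * (Z τ * N τ) + γ * N τ ^ 2)‖ ≤
        |α| * ‖Z τ‖ ^ 2 + |β| * (‖Z τ‖ * ‖N τ‖) + |γ| * ‖N τ‖ ^ 2 := by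
      rw [norm_neg]
      refine norm_add₃_le.trans_eq ?_
      simp
    have h3 : ∀ t : ℝ, t ≤ (‖Z τ‖ + ‖N τ‖) ^ 2 → t ≤ 2 * Real.exp (1 * (‖Z τ‖ + ‖N τ‖)) :=
      fun t ht => by nlinarith
    have h4 := h3 (‖Z τ‖ ^ 2) (by nlinarith [mul_nonneg hz hn])
    have h5 := h3 (‖Z τ‖ * ‖N τ‖) (by nlinarith [mul_nonneg hz hn])
    have h6 := h3 (‖N τ‖ ^ 2) (by nlinarith [mul_nonneg hz hn])
    calc _ ≤ _ := h2
      _ ≤ |α| * (2 * Real.exp (1 * (‖Z τ‖ + ‖N τ‖))) + |β| * (2 * Real.exp (1 * (‖Z τ‖ + ‖N τ‖)))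
          + |γ| * (2 * Real.exp (1 * (‖Z τ‖ + ‖N τ‖))) := by gcongr
      _ = _ := by rw [hM]; ring

theorem ExpMoments.quadOp_eq {W : T → ℂ} (hW : ExpMoments m Z N W)
    (hZ : AEStronglyMeasurable Z m) (hN : AEStronglyMeasurable N m) (α β γ : ℝ) :
    quadOp α β γ (planeWaves m Z N W) =
      planeWaves m Z N (fun τ => -(α * Z τ ^ 2 + β * (Z τ * N τ) + γ * N τ ^ 2) * W τ) := by
  have hWZ : ExpMoments m Z N (fun τ => (-Complex.I * Z τ) * W τ) := by
    simpa using hW.linear_mul hZ hN (-Complex.I) 0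
  have hWN : ExpMoments m Z N (fun τ => (-Complex.I * N τ) * W τ) := by
    simpa using hW.linear_mul hZ hN 0 (-Complex.I)
  have hZZ : ExpMoments m Z N (fun τ => (-Complex.I * Z τ) * ((-Complex.I * Z τ) * W τ)) := by
    simpa using hWZ.linear_mul hZ hN (-Complex.I) 0
  have hZN : ExpMoments m Z N (fun τ => (-Complex.I * Z τ) * ((-Complex.I * N τ) * W τ)) := by
    simpa using hWN.linear_mul hZ hN (-Complex.I) 0
  have hNN : ExpMoments m Z N (fun τ => (-Complex.I * N τ) * ((-Complex.I * N τ) * W τ)) := by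
    simpa using hWN.linear_mul hZ hN 0 (-Complex.I)
  funext x y
  rw [quadOp, hW.partialX_eq hZ hN, hW.partialY_eq hZ hN, hWZ.partialX_eq hZ hN,
    hWN.partialX_eq hZ hN, hWN.partialY_eq hZ hN]
  simp only [planeWaves]
  have i1 := (hZZ.integrable_planeWave hZ hN x y).const_mul (α : ℂ)
  have i2 := (hZN.integrable_planeWave hZ hN x y).const_mul (β : ℂ)
  have i3 := (hNN.integrable_planeWave hZ hN x y).const_mul (γ : ℂ)
  rw [← integral_const_mul, ← integral_const_mul, ← integral_const_mul, ← integral_add i1 i2]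
  refine (integral_add (i1.add i2) i3).symm.trans ?_
  refine integral_congr_ae (Eventually.of_forall fun τ => ?_)
  simp only [Pi.add_apply]
  linear_combination (W τ * Complex.exp (-Complex.I * (x * Z τ + y * N τ)) *
    (α * Z τ ^ 2 + β * (Z τ * N τ) + γ * N τ ^ 2)) * Complex.I_sq

theorem ExpMoments.quadOp_iterate {W : T → ℂ} (hW : ExpMoments m Z N W)
    (hZ : AEStronglyMeasurable Z m) (hN : AEStronglyMeasurable N m) (α β γ : ℝ) (n : ℕ) :
    (quadOp α β γ)^[n] (planeWaves m Z N W) = planeWaves m Z N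
      (fun τ => (-(α * Z τ ^ 2 + β * (Z τ * N τ) + γ * N τ ^ 2)) ^ n * W τ) ∧
      ExpMoments m Z N (fun τ => (-(α * Z τ ^ 2 + β * (Z τ * N τ) + γ * N τ ^ 2)) ^ n * W τ) := by
  induction n with
  | zero => simpa using hW
  | succ n ih =>
    have h := ih.2.quad_mul hZ hN α β γ
    have e : (fun τ => -(α * Z τ ^ 2 + β * (Z τ * N τ) + γ * N τ ^ 2) *
        ((-(α * Z τ ^ 2 + β * (Z τ * N τ) + γ * N τ ^ 2)) ^ n * W τ)) =
        fun τ => (-(α * Z τ ^ 2 + β * (Z τ * N τ) + γ * N τ ^ 2)) ^ (n + 1) * W τ := by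
      funext τ
      rw [pow_succ' _ n, mul_assoc]
    rw [e] at h
    refine ⟨?_, h⟩
    rw [Function.iterate_succ_apply', ih.1, ih.2.quadOp_eq hZ hN, e]

theorem ExpMoments.dirOp_eq {W : T → ℂ} (hW : ExpMoments m Z N W)
    (hZ : AEStronglyMeasurable Z m) (hN : AEStronglyMeasurable N m) (α β : ℝ) :
    dirOp α β (planeWaves m Z N W) =
      planeWaves m Z N (fun τ => (-Complex.I * α * Z τ + -Complex.I * β * N τ) * W τ) := by
  have hWZ : ExpMoments m Z N (fun τ => (-Complex.I * Z τ) * W τ) := by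
    simpa using hW.linear_mul hZ hN (-Complex.I) 0
  have hWN : ExpMoments m Z N (fun τ => (-Complex.I * N τ) * W τ) := by
    simpa using hW.linear_mul hZ hN 0 (-Complex.I)
  funext x y
  rw [dirOp, hW.partialX_eq hZ hN, hW.partialY_eq hZ hN]
  simp only [planeWaves]
  have i1 := (hWZ.integrable_planeWave hZ hN x y).const_mul (α : ℂ)
  have i2 := (hWN.integrable_planeWave hZ hN x y).const_mul (β : ℂ)
  rw [← integral_const_mul, ← integral_const_mul, ← integral_add i1 i2]
  refine integral_congr_ae (Eventually.of_forall fun τ => ?_)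
  simp only
  ring

/-- `(α ∂ₓ + β ∂ᵧ)²ⁿ` acts on a superposition of plane waves as the `n`-th power of a quadratic
symbol. -/
theorem ExpMoments.dirOp_iterate {W : T → ℂ} (hW : ExpMoments m Z N W)
    (hZ : AEStronglyMeasurable Z m) (hN : AEStronglyMeasurable N m) (α β : ℝ) (n : ℕ) :
    (dirOp α β)^[2 * n] (planeWaves m Z N W) = planeWaves m Z N
      (fun τ => (-(α * Z τ + β * N τ) ^ 2) ^ n * W τ) ∧
      ExpMoments m Z N (fun τ => (-(α * Z τ + β * N τ) ^ 2) ^ n * W τ) := by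
  induction n with
  | zero => simpa using hW
  | succ n ih =>
    have h1 := ih.2.linear_mul hZ hN (-Complex.I * α) (-Complex.I * β)
    have h2 := h1.linear_mul hZ hN (-Complex.I * α) (-Complex.I * β)
    have e : (fun τ => (-Complex.I * α * Z τ + -Complex.I * β * N τ) *
        ((-Complex.I * α * Z τ + -Complex.I * β * N τ) *
          ((-(α * Z τ + β * N τ) ^ 2) ^ n * W τ))) =
        fun τ => (-(α * Z τ + β * N τ) ^ 2) ^ (n + 1) * W τ := by
      funext τ
      linear_combination ((α * Z τ + β * N τ) ^ 2 * ((-(α * Z τ + β * N τ) ^ 2) ^ n * W τ)) *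
        Complex.I_sq
    rw [e] at h2
    refine ⟨?_, h2⟩
    rw [show 2 * (n + 1) = 2 * n + 1 + 1 by ring, Function.iterate_succ_apply',
      Function.iterate_succ_apply', ih.1, ih.2.dirOp_eq hZ hN, h1.dirOp_eq hZ hN, e]

/-- The exponential series of a symbol `q` may be summed under the integral as soon as
`exp ‖q‖` is integrable against the weight. -/
theorem hasSum_planeWaves_exp {W q : T → ℂ} {c : ℂ} (hW : AEStronglyMeasurable W m)
    (hZ : AEStronglyMeasurable Z m) (hN : AEStronglyMeasurable N m)
    (hq : AEStronglyMeasurable q m) {x y : ℝ}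
    (hint : Integrable (fun τ => Real.exp ((|x| + |y|) * (‖Z τ‖ + ‖N τ‖) + ‖c * q τ‖) * ‖W τ‖) m) :
    HasSum (fun n : ℕ => c ^ n / (n.factorial : ℂ) * planeWaves m Z N (fun τ => q τ ^ n * W τ) x y)
      (planeWaves m Z N (fun τ => Complex.exp (c * q τ) * W τ) x y) := by
  have hb : ∀ τ, ‖W τ * Complex.exp (-Complex.I * (x * Z τ + y * N τ))‖ ≤
      Real.exp ((|x| + |y|) * (‖Z τ‖ + ‖N τ‖)) * ‖W τ‖ := fun τ =>
    norm_planeWave_le W (by linarith [abs_nonneg y]) (by linarith [abs_nonneg x]) τ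
  have hreal : ∀ t : ℝ, HasSum (fun n : ℕ => t ^ n / (n.factorial : ℝ)) (Real.exp t) := fun t => by
    rw [Real.exp_eq_exp_ℝ]; exact NormedSpace.expSeries_div_hasSum_exp t
  have hcomplex : ∀ t : ℂ, HasSum (fun n : ℕ => t ^ n / (n.factorial : ℂ)) (Complex.exp t) :=
    fun t => by rw [Complex.exp_eq_exp_ℂ]; exact NormedSpace.expSeries_div_hasSum_exp t
  simp only [planeWaves, ← integral_const_mul]
  refine hasSum_integral_of_dominated_convergence
    (bound := fun (n : ℕ) τ => ‖c * q τ‖ ^ n / (n.factorial : ℝ) *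
      (Real.exp ((|x| + |y|) * (‖Z τ‖ + ‖N τ‖)) * ‖W τ‖)) (fun n => ?_)
    (fun n => Eventually.of_forall fun τ => ?_)
    (Eventually.of_forall fun τ => ((hreal _).mul_right _).summable) ?_
    (Eventually.of_forall fun τ => ?_)
  · exact (aestronglyMeasurable_planeWave ((hq.pow n).mul hW) hZ hN x y).const_mul _
  · have e : c ^ n / (n.factorial : ℂ) * (q τ ^ n * W τ *
        Complex.exp (-Complex.I * (x * Z τ + y * N τ))) = (c * q τ) ^ n / (n.factorial : ℂ) *
        (W τ * Complex.exp (-Complex.I * (x * Z τ + y * N τ))) := by ring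
    rw [e, norm_mul]
    gcongr
    · simp
    · exact hb τ
  · refine hint.congr (Eventually.of_forall fun τ => ?_)
    simp only
    rw [((hreal ‖c * q τ‖).mul_right _).tsum_eq, Real.exp_add]
    ring
  · have := (hcomplex (c * q τ)).mul_right
      (W τ * Complex.exp (-Complex.I * (x * Z τ + y * N τ)))
    have e : ∀ n : ℕ, (c * q τ) ^ n / (n.factorial : ℂ) *
        (W τ * Complex.exp (-Complex.I * (x * Z τ + y * N τ))) = c ^ n / (n.factorial : ℂ) *
        (q τ ^ n * W τ * Complex.exp (-Complex.I * (x * Z τ + y * N τ))) := fun n => by ring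
    simp only [e] at this
    rw [mul_assoc]
    exact this

end PlaneWave

/-! ### The elliptic umbilic integral -/

theorem fourierTrunc_umbilicInitial (x y z : ℝ) (r : (ℝ × ℝ) × (ℝ × ℝ)) :
    fourierTrunc (umbilicInitial z) x y r = 1 / (2 * (Real.pi : ℂ)) *
      ∫ ξ in r.1.1..r.1.2, ∫ η in r.2.1..r.2.2, regIntegrand z 0 z x y 0 ξ η := by
  have h : ∀ ξ η : ℝ, Complex.exp (-Complex.I * ((x : ℂ) * ξ + (y : ℂ) * η)) *
      umbilicInitial z ξ η = regIntegrand z 0 z x y 0 ξ η := fun ξ η => by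
    rw [umbilicInitial, ← Complex.exp_add, regIntegrand]
    congr 1
    push_cast
    ring
  simp only [fourierTrunc, h]

theorem regIntegrand_add (a b x y z ξ η : ℝ) :
    regIntegrand z 0 z x y 0 (ξ + a) (η + b) =
      Complex.exp (-Complex.I * a * x - Complex.I * b * y
            - Complex.I * z * ((a : ℂ) ^ 2 + (b : ℂ) ^ 2)
            + Complex.I * ((a : ℂ) ^ 3 - 3 * (a : ℂ) * (b : ℂ) ^ 2)) *
        regIntegrand (z - 3 * a) (6 * b) (z + 3 * a) (x + (2 * a * z - 3 * (a ^ 2 - b ^ 2)))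
          (y + (2 * b * z + 6 * a * b)) 0 ξ η := by
  rw [regIntegrand, regIntegrand, ← Complex.exp_add]
  congr 1
  push_cast
  ring

theorem tendsto_exhaustPlane_shift (a b : ℝ) :
    Tendsto (fun r : (ℝ × ℝ) × (ℝ × ℝ) => ((r.1.1 - a, r.1.2 - a), (r.2.1 - b, r.2.2 - b)))
      exhaustPlane exhaustPlane := by
  have h1 := tendsto_exhaustPlane_left_fst
  have h2 := tendsto_exhaustPlane_left_snd
  have h3 := tendsto_exhaustPlane_right_fst
  have h4 := tendsto_exhaustPlane_right_snd
  exact ((tendsto_atBot_add_const_right _ (-a) h1).prodMk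
    (tendsto_atTop_add_const_right _ (-a) h2)).prodMk
    ((tendsto_atBot_add_const_right _ (-b) h3).prodMk (tendsto_atTop_add_const_right _ (-b) h4))

/-- Shifting the rectangles by `(a, b)` turns the quadratic form `z (ξ² + η²)` into
`(z - 3a) ξ² + 6b ξη + (z + 3a) η²`; the improper integral is then evaluated on the chain. -/
theorem tendsto_fourierTrunc_umbilic (a b x y z : ℝ) {K R : ℝ}
    (hR : |z - 3 * a| + |6 * b| + |z + 3 * a| + 1 ≤ R) (hRK : 2 * R + 2 ≤ K) :
    Tendsto (fourierTrunc (umbilicInitial z) x y) exhaustPlane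
      (𝓝 (Complex.exp (-Complex.I * a * x - Complex.I * b * y
            - Complex.I * z * ((a : ℂ) ^ 2 + (b : ℂ) ^ 2)
            + Complex.I * ((a : ℂ) ^ 3 - 3 * (a : ℂ) * (b : ℂ) ^ 2)) *
        (1 / (2 * (Real.pi : ℂ)) * ∫ p, chainIntegrand (z - 3 * a) (6 * b) (z + 3 * a)
          (x + (2 * a * z - 3 * (a ^ 2 - b ^ 2))) (y + (2 * b * z + 6 * a * b)) 0 K p))) := by
  have h := (tendsto_integral_rect_chain (z - 3 * a) (6 * b) (z + 3 * a)
    (x + (2 * a * z - 3 * (a ^ 2 - b ^ 2))) (y + (2 * b * z + 6 * a * b)) hR hRK).comp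
    (tendsto_exhaustPlane_shift a b)
  refine ((h.const_mul (1 / (2 * (Real.pi : ℂ)))).const_mul _).congr fun r => ?_
  rw [fourierTrunc_umbilicInitial, mul_left_comm]
  congr 1
  have e1 : ∀ ξ : ℝ, ∫ η in r.2.1..r.2.2, regIntegrand z 0 z x y 0 ξ η =
      ∫ η in (r.2.1 - b)..(r.2.2 - b), regIntegrand z 0 z x y 0 ξ (η + b) := fun ξ => by
    rw [intervalIntegral.integral_comp_add_right (fun η => regIntegrand z 0 z x y 0 ξ η),
      sub_add_cancel, sub_add_cancel]
  have e2 : ∫ ξ in r.1.1..r.1.2, ∫ η in r.2.1..r.2.2, regIntegrand z 0 z x y 0 ξ η =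
      ∫ ξ in (r.1.1 - a)..(r.1.2 - a), ∫ η in r.2.1..r.2.2,
        regIntegrand z 0 z x y 0 (ξ + a) η := by
    rw [intervalIntegral.integral_comp_add_right
      (fun ξ => ∫ η in r.2.1..r.2.2, regIntegrand z 0 z x y 0 ξ η),
      sub_add_cancel, sub_add_cancel]
  rw [e2]
  simp only [e1, regIntegrand_add, intervalIntegral.integral_const_mul, Function.comp_apply]

theorem ellipticUmbilic_eq_chain (a b x y z : ℝ) {K R : ℝ}
    (hR : |z - 3 * a| + |6 * b| + |z + 3 * a| + 1 ≤ R) (hRK : 2 * R + 2 ≤ K) :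
    ellipticUmbilic x y z = Complex.exp (-Complex.I * a * x - Complex.I * b * y
            - Complex.I * z * ((a : ℂ) ^ 2 + (b : ℂ) ^ 2)
            + Complex.I * ((a : ℂ) ^ 3 - 3 * (a : ℂ) * (b : ℂ) ^ 2)) *
        (1 / (2 * (Real.pi : ℂ)) * ∫ p, chainIntegrand (z - 3 * a) (6 * b) (z + 3 * a)
          (x + (2 * a * z - 3 * (a ^ 2 - b ^ 2))) (y + (2 * b * z + 6 * a * b)) 0 K p) :=
  (tendsto_fourierTrunc_umbilic a b x y z hR hRK).limUnder_eq

theorem tendsto_fourierTrunc_ellipticUmbilic (x y z : ℝ) :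
    Tendsto (fourierTrunc (umbilicInitial z) x y) exhaustPlane (𝓝 (ellipticUmbilic x y z)) :=
  tendsto_nhds_limUnder ⟨_, tendsto_fourierTrunc_umbilic 0 0 x y z le_rfl le_rfl⟩

/-- Weight of the representation of `E(x + c, y + d, 0)` as a superposition of plane waves over
the chain. -/
noncomputable def shiftedWeight (K c d : ℝ) (p : ℝ × ℝ) : ℂ :=
  Complex.exp (-Complex.I * (c * chainXi K p + d * chainEta K p)) *
    (1 / (2 * (Real.pi : ℂ)) * chainWeight K p)

section Chain

variable {K : ℝ}

theorem aestronglyMeasurable_chainXi (hK : 0 < K) :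
    AEStronglyMeasurable (chainXi K) (volume : Measure (ℝ × ℝ)) :=
  (continuous_chainXi hK).aestronglyMeasurable

theorem aestronglyMeasurable_chainEta (hK : 0 < K) :
    AEStronglyMeasurable (chainEta K) (volume : Measure (ℝ × ℝ)) :=
  (continuous_chainEta hK).aestronglyMeasurable

theorem norm_inv_two_pi_mul_le (w : ℂ) : ‖1 / (2 * (Real.pi : ℂ)) * w‖ ≤ ‖w‖ := by
  rw [norm_mul]
  refine mul_le_of_le_one_left (norm_nonneg w) ?_
  rw [norm_div, norm_one, norm_mul, Complex.norm_real, Real.norm_of_nonneg Real.pi_pos.le,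
    Complex.norm_two, div_le_one (by positivity)]
  linarith [Real.pi_gt_three]

theorem expMoments_shiftedWeight (hK : 2 ≤ K) (c d : ℝ) :
    ExpMoments volume (chainXi K) (chainEta K) (shiftedWeight K c d) := by
  have hK0 : 0 < K := by linarith
  have hZ := aestronglyMeasurable_chainXi hK0
  have hN := aestronglyMeasurable_chainEta hK0
  have h0 : ExpMoments volume (chainXi K) (chainEta K)
      (fun p => 1 / (2 * (Real.pi : ℂ)) * chainWeight K p) := by
    have hm := ((continuous_chainWeight hK0).aestronglyMeasurable
      (μ := (volume : Measure (ℝ × ℝ)))).const_mul (1 / (2 * (Real.pi : ℂ)))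
    refine ⟨hm, fun r => ?_⟩
    refine (integrable_exp_mul_norm_chainWeight le_rfl (by linarith) r).mono' ?_
      (Eventually.of_forall fun p => ?_)
    · exact (Real.continuous_exp.comp_aestronglyMeasurable
        ((hZ.norm.add hN.norm).const_mul r)).mul hm.norm
    · rw [Real.norm_of_nonneg (by positivity), zero_mul, add_zero]
      gcongr
      exact norm_inv_two_pi_mul_le _
  exact h0.exp_linear_mul hZ hN c d

theorem ellipticUmbilic_shift_eq_planeWaves (hK : 4 ≤ K) (c d : ℝ) :
    (fun u v => ellipticUmbilic (u + c) (v + d) 0) =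
      planeWaves volume (chainXi K) (chainEta K) (shiftedWeight K c d) := by
  funext u v
  rw [ellipticUmbilic_eq_chain 0 0 (u + c) (v + d) 0 (R := 1) (by simp) (by linarith),
    ← integral_const_mul, ← integral_const_mul, planeWaves]
  refine integral_congr_ae (Eventually.of_forall fun p => ?_)
  have h1 : Complex.exp (-Complex.I * (0 : ℝ) * (u + c : ℝ) - Complex.I * (0 : ℝ) * (v + d : ℝ)
      - Complex.I * (0 : ℝ) * (((0 : ℝ) : ℂ) ^ 2 + ((0 : ℝ) : ℂ) ^ 2)
      + Complex.I * (((0 : ℝ) : ℂ) ^ 3 - 3 * ((0 : ℝ) : ℂ) * ((0 : ℝ) : ℂ) ^ 2)) = 1 := by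
    simp
  simp only [h1, one_mul, chainIntegrand, shiftedWeight]
  have h2 : ∀ α β γ δ : ℂ, α * (β * γ) * δ = β * (γ * (α * δ)) := fun α β γ δ => by ring
  rw [h2, ← Complex.exp_add]
  congr 3
  push_cast
  ring

theorem contDiff_ellipticUmbilic_zero :
    ContDiff ℝ ∞ (fun p : ℝ × ℝ => ellipticUmbilic p.1 p.2 0) := by
  have h := (expMoments_shiftedWeight (K := 4) (by norm_num) 0 0).contDiff
    (aestronglyMeasurable_chainXi (by norm_num)) (aestronglyMeasurable_chainEta (by norm_num))
  rw [← ellipticUmbilic_shift_eq_planeWaves le_rfl] at h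
  simpa using h

/-- The expansion after a shift by `(a, b)`: applied to the plane waves
`exp (-i (x ξ + y η))`, the operator series is the exponential series of
`-i ((z - 3a) ξ² + 6b ξη + (z + 3a) η²)`. -/
theorem ellipticUmbilic_eq_tsum_quadOp (a b x y z : ℝ) {c d : ℝ}
    (hc : c = 2 * a * z - 3 * (a ^ 2 - b ^ 2)) (hd : d = 2 * b * z + 6 * a * b) :
    Summable (fun n : ℕ => Complex.I ^ n / (n.factorial : ℂ) *
        ((quadOp (z - 3 * a) (6 * b) (z + 3 * a))^[n] (fun u v =>
          ellipticUmbilic (u + c) (v + d) 0)) x y) ∧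
      ellipticUmbilic x y z =
        Complex.exp (-Complex.I * a * x - Complex.I * b * y
            - Complex.I * z * ((a : ℂ) ^ 2 + (b : ℂ) ^ 2)
            + Complex.I * ((a : ℂ) ^ 3 - 3 * (a : ℂ) * (b : ℂ) ^ 2)) *
          ∑' n : ℕ, Complex.I ^ n / (n.factorial : ℂ) *
            ((quadOp (z - 3 * a) (6 * b) (z + 3 * a))^[n] (fun u v =>
              ellipticUmbilic (u + c) (v + d) 0)) x y := by
  set A := z - 3 * a with hA
  set B := 6 * b with hB
  set C := z + 3 * a with hC
  set R := |A| + |B| + |C| + 1 with hR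
  set K := 2 * R + 2 with hKR
  have hR1 : 1 ≤ R := by
    have := abs_nonneg A
    have := abs_nonneg B
    have := abs_nonneg C
    linarith
  have hK : 4 ≤ K := by linarith
  have hK0 : 0 < K := by linarith
  have hZ := aestronglyMeasurable_chainXi hK0
  have hN := aestronglyMeasurable_chainEta hK0
  have hW := expMoments_shiftedWeight (K := K) (by linarith) c d
  rw [ellipticUmbilic_shift_eq_planeWaves hK c d]
  simp only [(hW.quadOp_iterate hZ hN A B C _).1]
  have hq : AEStronglyMeasurable (fun p => -((A : ℂ) * chainXi K p ^ 2 +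
      B * (chainXi K p * chainEta K p) + C * chainEta K p ^ 2)) (volume : Measure (ℝ × ℝ)) :=
    ((((hZ.pow 2).const_mul _).add ((hZ.mul hN).const_mul _)).add ((hN.pow 2).const_mul _)).neg
  have hsum := hasSum_planeWaves_exp (c := Complex.I) (x := x) (y := y) hW.1 hZ hN hq ?_
  · refine ⟨hsum.summable, ?_⟩
    rw [hsum.tsum_eq, ellipticUmbilic_eq_chain a b x y z (le_refl R) (le_refl K), ← hc, ← hd]
    congr 1
    rw [← integral_const_mul, planeWaves]
    refine integral_congr_ae (Eventually.of_forall fun p => ?_)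
    simp only [chainIntegrand, shiftedWeight, ← hA, ← hB, ← hC]
    have h2 : ∀ α β γ δ ε : ℂ, α * (β * (γ * δ)) * ε = γ * (δ * (α * β * ε)) :=
      fun α β γ δ ε => by ring
    rw [h2, ← Complex.exp_add, ← Complex.exp_add]
    congr 3
    push_cast
    ring
  · have hint := integrable_exp_mul_norm_chainWeight (R := R) (by linarith) (le_refl K)
      (|x| + |y| + (|c| + |d|))
    refine hint.mono' ?_ (Eventually.of_forall fun p => ?_)
    · exact (Real.continuous_exp.comp_aestronglyMeasurable
        (((hZ.norm.add hN.norm).const_mul (|x| + |y|)).add (hq.const_mul Complex.I).norm)).mul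
        hW.1.norm
    · rw [Real.norm_of_nonneg (by positivity)]
      have b1 : ‖shiftedWeight K c d p‖ ≤ Real.exp ((|c| + |d|) * (‖chainXi K p‖ + ‖chainEta K p‖))
          * ‖chainWeight K p‖ := by
        rw [shiftedWeight, mul_comm]
        refine (norm_planeWave_le (fun p => 1 / (2 * (Real.pi : ℂ)) * chainWeight K p)
          (r := |c| + |d|) (by linarith [abs_nonneg d]) (by linarith [abs_nonneg c]) p).trans ?_
        gcongr
        exact norm_inv_two_pi_mul_le _
      have b2 := norm_chainExponent_le A B C 0 0 (le_refl 0) zero_le_one (le_refl R)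
        (chainXi K p) (chainEta K p)
      have b3 : ‖Complex.I * -((A : ℂ) * chainXi K p ^ 2 +
          B * (chainXi K p * chainEta K p) + C * chainEta K p ^ 2)‖ ≤
          R * (‖chainXi K p‖ ^ 2 + ‖chainEta K p‖ ^ 2) := by
        rw [mul_neg, norm_neg]
        simpa using b2
      calc _ ≤ Real.exp ((|x| + |y|) * (‖chainXi K p‖ + ‖chainEta K p‖) +
            R * (‖chainXi K p‖ ^ 2 + ‖chainEta K p‖ ^ 2)) *
            (Real.exp ((|c| + |d|) * (‖chainXi K p‖ + ‖chainEta K p‖)) * ‖chainWeight K p‖) := by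
            gcongr
        _ = _ := by
            rw [← mul_assoc, ← Real.exp_add]
            ring_nf

/-- When the quadratic symbol is a square, the second-order operator is the square of a
directional derivative. -/
theorem quadOp_term_eq_dirOp_term (c d α β x y z : ℝ) (n : ℕ) :
    Complex.I ^ n / (n.factorial : ℂ) * ((quadOp (2 * z * α ^ 2) (4 * z * (α * β))
        (2 * z * β ^ 2))^[n] (fun u v => ellipticUmbilic (u + c) (v + d) 0)) x y =
      (2 * Complex.I * z) ^ n / (n.factorial : ℂ) *
        ((dirOp α β)^[2 * n] (fun u v => ellipticUmbilic (u + c) (v + d) 0)) x y := by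
  have hZ := aestronglyMeasurable_chainXi (K := 4) (by norm_num)
  have hN := aestronglyMeasurable_chainEta (K := 4) (by norm_num)
  have hW := expMoments_shiftedWeight (K := 4) (by norm_num) c d
  rw [ellipticUmbilic_shift_eq_planeWaves le_rfl, (hW.quadOp_iterate hZ hN _ _ _ n).1,
    (hW.dirOp_iterate hZ hN _ _ n).1]
  simp only [planeWaves]
  rw [← integral_const_mul, ← integral_const_mul]
  refine integral_congr_ae (Eventually.of_forall fun p => ?_)
  have e : -(((2 * z * α ^ 2 : ℝ) : ℂ) * chainXi 4 p ^ 2 + ((4 * z * (α * β) : ℝ) : ℂ) *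
      (chainXi 4 p * chainEta 4 p) + ((2 * z * β ^ 2 : ℝ) : ℂ) * chainEta 4 p ^ 2) =
      2 * z * -(α * chainXi 4 p + β * chainEta 4 p) ^ 2 := by
    push_cast; ring
  simp only [e]
  rw [mul_pow (2 * (z : ℂ)), show 2 * Complex.I * z = Complex.I * (2 * z) by ring,
    mul_pow Complex.I]
  ring

end Chain

/-! ### Caustic points -/

theorem mem_caustic (t₀ z : ℝ) :
    (z ^ 2 / 3 * (2 * Real.cos t₀ + Real.cos (2 * t₀)),
      z ^ 2 / 3 * (2 * Real.sin t₀ - Real.sin (2 * t₀))) ∈ caustic z := by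
  refine ⟨toIcoMod Real.two_pi_pos 0 t₀, ?_, ?_⟩
  · simpa using toIcoMod_mem_Ico Real.two_pi_pos 0 t₀
  · have hper : Complex.exp (Complex.I * (toIcoMod Real.two_pi_pos 0 t₀ : ℝ)) =
        Complex.exp (Complex.I * t₀) := by
      rw [Complex.exp_eq_exp_iff_exists_int]
      refine ⟨-toIcoDiv Real.two_pi_pos 0 t₀, ?_⟩
      rw [toIcoMod]
      push_cast [zsmul_eq_mul]
      ring
    have hcube : ∀ t : ℝ, Complex.exp (-3 * Complex.I * t) = (Complex.exp (Complex.I * t))⁻¹ ^ 3 :=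
      fun t => by
        rw [← Complex.exp_neg, ← Complex.exp_nat_mul]
        congr 1
        push_cast
        ring
    have hE : Complex.exp (Complex.I * t₀) ≠ 0 := Complex.exp_ne_zero _
    have h1 : Complex.exp (Complex.I * t₀) = Complex.cos t₀ + Complex.sin t₀ * Complex.I := by
      rw [mul_comm, Complex.exp_mul_I]
    have h2 : (Complex.exp (Complex.I * t₀))⁻¹ = Complex.cos t₀ - Complex.sin t₀ * Complex.I := by
      rw [← Complex.exp_neg, show -(Complex.I * (t₀ : ℂ)) = (-t₀ : ℂ) * Complex.I by ring,
        Complex.exp_mul_I, Complex.cos_neg, Complex.sin_neg]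
      ring
    rw [hcube, hper]
    have h3 : Complex.exp (Complex.I * t₀) * (2 + (Complex.exp (Complex.I * t₀))⁻¹ ^ 3) =
        2 * Complex.exp (Complex.I * t₀) + (Complex.exp (Complex.I * t₀))⁻¹ ^ 2 := by
      field_simp
    rw [mul_assoc, h3, h2, h1]
    push_cast
    rw [Complex.cos_two_mul, Complex.sin_two_mul]
    linear_combination ((z : ℂ) ^ 2 / 3) *
      (-Complex.sin t₀ ^ 2 * Complex.I_sq + Complex.sin_sq_add_cos_sq (t₀ : ℂ))

/-- At `a = -(z / 3) cos t₀`, `b = -(z / 3) sin t₀` the quadratic form degenerates to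
`2 z (cos (t₀ / 2) ξ - sin (t₀ / 2) η)²`. -/
theorem ellipticUmbilic_eq_tsum_dirOp (t₀ x₀ y₀ z : ℝ)
    (hx₀ : x₀ = z ^ 2 / 3 * (2 * Real.cos t₀ + Real.cos (2 * t₀)))
    (hy₀ : y₀ = z ^ 2 / 3 * (2 * Real.sin t₀ - Real.sin (2 * t₀))) (x y : ℝ) :
    Summable (fun n : ℕ => (2 * Complex.I * z) ^ n / (n.factorial : ℂ) *
        ((dirOp (Real.cos (t₀ / 2)) (-Real.sin (t₀ / 2)))^[2 * n]
          (fun u v => ellipticUmbilic (u - x₀) (v - y₀) 0)) x y) ∧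
      ellipticUmbilic x y z =
        Complex.exp (Complex.I * z / 3 * (x * Real.cos t₀ + y * Real.sin t₀)
            - Complex.I * (z : ℂ) ^ 3 / 27 * (3 + Real.cos (3 * t₀))) *
          ∑' n : ℕ, (2 * Complex.I * z) ^ n / (n.factorial : ℂ) *
            ((dirOp (Real.cos (t₀ / 2)) (-Real.sin (t₀ / 2)))^[2 * n]
              (fun u v => ellipticUmbilic (u - x₀) (v - y₀) 0)) x y := by
  set a : ℝ := -(z / 3) * Real.cos t₀ with ha
  set b : ℝ := -(z / 3) * Real.sin t₀ with hb
  have hcos : Real.cos t₀ = 2 * Real.cos (t₀ / 2) ^ 2 - 1 := by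
    rw [← Real.cos_two_mul]; congr 1; ring
  have hsin : Real.sin t₀ = 2 * Real.sin (t₀ / 2) * Real.cos (t₀ / 2) := by
    rw [← Real.sin_two_mul]; congr 1; ring
  have hone := Real.sin_sq_add_cos_sq (t₀ / 2)
  have hone' := Real.sin_sq_add_cos_sq t₀
  have e1 : z - 3 * a = 2 * z * Real.cos (t₀ / 2) ^ 2 := by rw [ha, hcos]; ring
  have e2 : 6 * b = 4 * z * (Real.cos (t₀ / 2) * -Real.sin (t₀ / 2)) := by rw [hb, hsin]; ring
  have e3 : z + 3 * a = 2 * z * (-Real.sin (t₀ / 2)) ^ 2 := by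
    rw [ha, hcos]; linear_combination -2 * z * hone
  have hc : -x₀ = 2 * a * z - 3 * (a ^ 2 - b ^ 2) := by
    rw [hx₀, ha, hb, Real.cos_two_mul]; linear_combination -z ^ 2 / 3 * hone'
  have hd : -y₀ = 2 * b * z + 6 * a * b := by
    rw [hy₀, ha, hb, Real.sin_two_mul]; ring
  have key := ellipticUmbilic_eq_tsum_quadOp a b x y z hc hd
  rw [e1, e2, e3] at key
  simp only [quadOp_term_eq_dirOp_term] at key
  simp only [← sub_eq_add_neg] at key
  refine ⟨key.1, key.2.trans ?_⟩
  congr 2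
  rw [ha, hb]
  push_cast
  rw [Complex.cos_three_mul]
  have hone'' := Complex.sin_sq_add_cos_sq (t₀ : ℂ)
  linear_combination (-Complex.I * (z : ℂ) ^ 3 / 9 + Complex.I * z ^ 3 / 9 * Complex.cos t₀) * hone''

theorem dirOp_one_zero : dirOp 1 0 = partialX := by
  funext F x y
  simp [dirOp]

theorem partialY_neg (F : ℝ → ℝ → ℂ) : partialY (-F) = -partialY F := by
  funext x y
  exact deriv.fun_neg

theorem dirOp_zero_neg_one_iterate (n : ℕ) : (dirOp 0 (-1))^[2 * n] = partialY^[2 * n] := by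
  have h : ∀ F, dirOp 0 (-1) F = -partialY F := fun F => by
    funext x y
    simp [dirOp]
  have h2 : (dirOp 0 (-1))^[2] = partialY^[2] := by
    funext F
    simp only [Function.iterate_succ, Function.iterate_zero, Function.comp_apply, id_eq]
    rw [h, h, partialY_neg, neg_neg]
  rw [Function.iterate_mul, Function.iterate_mul, h2]

theorem mainTheorem2 :
    -- the improper integral defining `E` converges, and `E(·, ·, 0)` is smooth
    (∀ x y z : ℝ, Tendsto (fourierTrunc (umbilicInitial z) x y) exhaustPlane
      (𝓝 (ellipticUmbilic x y z))) ∧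
    ContDiff ℝ ∞ (fun p : ℝ × ℝ => ellipticUmbilic p.1 p.2 0) ∧
    -- expansion after the shift of the integration variables by an arbitrary `(a, b)`
    (∀ a b x y z : ℝ,
      Summable (fun n : ℕ => Complex.I ^ n / (n.factorial : ℂ) *
        ((quadOp (z - 3 * a) (6 * b) (z + 3 * a))^[n] (fun u v =>
          ellipticUmbilic (u + 2 * a * z - 3 * (a ^ 2 - b ^ 2)) (v + 2 * b * z + 6 * a * b) 0))
          x y) ∧
      ellipticUmbilic x y z =
        Complex.exp (-Complex.I * a * x - Complex.I * b * y
            - Complex.I * z * ((a : ℂ) ^ 2 + (b : ℂ) ^ 2)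
            + Complex.I * ((a : ℂ) ^ 3 - 3 * (a : ℂ) * (b : ℂ) ^ 2)) *
          ∑' n : ℕ, Complex.I ^ n / (n.factorial : ℂ) *
            ((quadOp (z - 3 * a) (6 * b) (z + 3 * a))^[n] (fun u v =>
              ellipticUmbilic (u + 2 * a * z - 3 * (a ^ 2 - b ^ 2)) (v + 2 * b * z + 6 * a * b) 0))
              x y) ∧
    -- expansion about the caustic point `(x₀, y₀)` with parameter `t₀`
    (∀ t₀ x₀ y₀ z : ℝ,
      x₀ = z ^ 2 / 3 * (2 * Real.cos t₀ + Real.cos (2 * t₀)) →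
      y₀ = z ^ 2 / 3 * (2 * Real.sin t₀ - Real.sin (2 * t₀)) →
      (x₀, y₀) ∈ caustic z ∧
      ∀ x y : ℝ,
        Summable (fun n : ℕ => (2 * Complex.I * z) ^ n / (n.factorial : ℂ) *
          ((dirOp (Real.cos (t₀ / 2)) (-Real.sin (t₀ / 2)))^[2 * n]
            (fun u v => ellipticUmbilic (u - x₀) (v - y₀) 0)) x y) ∧
        ellipticUmbilic x y z =
          Complex.exp (Complex.I * z / 3 * (x * Real.cos t₀ + y * Real.sin t₀)
              - Complex.I * (z : ℂ) ^ 3 / 27 * (3 + Real.cos (3 * t₀))) *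
            ∑' n : ℕ, (2 * Complex.I * z) ^ n / (n.factorial : ℂ) *
              ((dirOp (Real.cos (t₀ / 2)) (-Real.sin (t₀ / 2)))^[2 * n]
                (fun u v => ellipticUmbilic (u - x₀) (v - y₀) 0)) x y) ∧
    -- expansion about the caustic point `(z², 0)`
    (∀ z : ℝ, (z ^ 2, (0 : ℝ)) ∈ caustic z ∧
      ∀ x y : ℝ,
        Summable (fun n : ℕ => (2 * Complex.I * z) ^ n / (n.factorial : ℂ) *
          (partialX^[2 * n] (fun u v => ellipticUmbilic (u - z ^ 2) v 0)) x y) ∧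
        ellipticUmbilic x y z =
          Complex.exp (Complex.I * x * z / 3 - 4 * Complex.I * (z : ℂ) ^ 3 / 27) *
            ∑' n : ℕ, (2 * Complex.I * z) ^ n / (n.factorial : ℂ) *
              (partialX^[2 * n] (fun u v => ellipticUmbilic (u - z ^ 2) v 0)) x y) ∧
    -- expansion about the caustic point `(-z² / 3, 0)`
    (∀ z : ℝ, (-z ^ 2 / 3, (0 : ℝ)) ∈ caustic z ∧
      ∀ x y : ℝ,
        Summable (fun n : ℕ => (2 * Complex.I * z) ^ n / (n.factorial : ℂ) *
          (partialY^[2 * n] (fun u v => ellipticUmbilic (u + z ^ 2 / 3) v 0)) x y) ∧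
        ellipticUmbilic x y z =
          Complex.exp (-Complex.I * x * z / 3 - 2 * Complex.I * (z : ℂ) ^ 3 / 27) *
            ∑' n : ℕ, (2 * Complex.I * z) ^ n / (n.factorial : ℂ) *
              (partialY^[2 * n] (fun u v => ellipticUmbilic (u + z ^ 2 / 3) v 0)) x y) := by
  refine ⟨tendsto_fourierTrunc_ellipticUmbilic, contDiff_ellipticUmbilic_zero, ?_, ?_, ?_, ?_⟩
  · intro a b x y z
    have key := ellipticUmbilic_eq_tsum_quadOp a b x y z rfl rfl
    simpa only [← add_sub_assoc, ← add_assoc] using key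
  · rintro t₀ x₀ y₀ z hx₀ hy₀
    refine ⟨?_, ellipticUmbilic_eq_tsum_dirOp t₀ x₀ y₀ z hx₀ hy₀⟩
    rw [hx₀, hy₀]
    exact mem_caustic t₀ z
  · intro z
    have hx₀ : z ^ 2 = z ^ 2 / 3 * (2 * Real.cos 0 + Real.cos (2 * 0)) := by
      simp only [mul_zero, Real.cos_zero]; ring
    have hy₀ : (0 : ℝ) = z ^ 2 / 3 * (2 * Real.sin 0 - Real.sin (2 * 0)) := by simp
    refine ⟨?_, fun x y => ?_⟩
    · have h := mem_caustic 0 z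
      rwa [← hx₀, ← hy₀] at h
    · have key := ellipticUmbilic_eq_tsum_dirOp 0 (z ^ 2) 0 z hx₀ hy₀ x y
      simp only [zero_div, Real.cos_zero, Real.sin_zero, neg_zero, dirOp_one_zero, sub_zero,
        mul_zero] at key
      refine ⟨key.1, key.2.trans ?_⟩
      congr 2
      push_cast
      ring
  · intro z
    have hcos : Real.cos (2 * Real.pi) = 1 := Real.cos_two_pi
    have hcos3 : Real.cos (3 * Real.pi) = -1 := by
      rw [show 3 * Real.pi = Real.pi + 2 * Real.pi by ring, Real.cos_add_two_pi, Real.cos_pi]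
    have hx₀ : -z ^ 2 / 3 =
        z ^ 2 / 3 * (2 * Real.cos Real.pi + Real.cos (2 * Real.pi)) := by
      rw [hcos, Real.cos_pi]; ring
    have hy₀ : (0 : ℝ) = z ^ 2 / 3 * (2 * Real.sin Real.pi - Real.sin (2 * Real.pi)) := by simp
    refine ⟨?_, fun x y => ?_⟩
    · have h := mem_caustic Real.pi z
      rwa [← hx₀, ← hy₀] at h
    · have key := ellipticUmbilic_eq_tsum_dirOp Real.pi (-z ^ 2 / 3) 0 z hx₀ hy₀ x y
      have hshift : ∀ u : ℝ, u - -z ^ 2 / 3 = u + z ^ 2 / 3 := fun u => by ring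
      simp only [Real.cos_pi_div_two, Real.sin_pi_div_two, dirOp_zero_neg_one_iterate, sub_zero,
        hshift, Real.cos_pi, Real.sin_pi, hcos3] at key
      refine ⟨key.1, key.2.trans ?_⟩
      congr 2
      push_cast
      ring
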